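/- Let $N\ge 2$ and let $n$ be the integer with $N=2n$ or $N=2n-1$. Let $\hbar\in\mathbb C$ and put $\eta=\frac{\pi i}{2\hbar}$ (formally $\eta=0$ if $\hbar=0$). Let $\Omega\subseteq\mathbb C$ satisfy $u+r+s\eta\in\Omega$ for all $u\in\Omega$ and $r,s\in\mathbb Z$. Let $Q_1,\dots,Q_n:\mathbb C\to\mathbb C$ have no zeros on $\Omega$ and be quasi-periodic on $\Omega$: for each $a$ there is $h_a\in\mathbb C$ with $Q_a(u+2\eta)=h_aQ_a(u)$ for all $u\in\Omega$. (For example, for meromorphic $Q_a\not\equiv0$ one may take for $\Omega$ the complement of a suitable countable set.) Put $Y_0(u)=1$ and $Y_a(u)=\frac{Q_a(u-1)}{Q_a(u+1)}$ for $1\le a\le n$. If $N=2n$, put $$x_a(u)=\frac{Y_a(u+a)}{Y_{a-1}(u+a+1)},\qquad x_{2n-a+2}(u)=\frac{Y_{a-1}(u+2n-a+2+\eta)}{Y_a(u+2n-a+3+\eta)}\quad(1\le a\le n),\qquad x_{n+1}(u)=\frac{Y_n(u+n+1+\eta)}{Y_n(u+n+2)}.$$ If $N=2n-1$, put $$x_a(u)=\frac{Y_a(u+a)}{Y_{a-1}(u+a+1)},\qquad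 x_{2n-a+1}(u)=\frac{Y_{a-1}(u+2n-a+1+\eta)}{Y_a(u+2n-a+2+\eta)}\quad(1\le a\le n-1),$$ $$x_n(u)=\frac{Y_n(u+n)\,Y_n(u+n+\eta)}{Y_{n-1}(u+n+1)},\qquad x_{n+1}(u)=\frac{Y_{n-1}(u+n+1+\eta)}{Y_n(u+n+2)\,Y_n(u+n+2+\eta)}.$$ Let $D$ be the shift operator, $Df(u)=f(u+2)D$, and define $$L(u)=(1-x_{N+1}(u)D)(1-x_N(u)D)\cdots(1-x_1(u)D)=\sum_{a=0}^{N+1}(-1)^aT^a(u+a)D^a ,$$ which defines the functions $T^a(u)$; put $T^a(u)=0$ for $a<0$ and for $a>N+1$. For $1\le a\le N+1$ let $L_a(u)$ be the product of the operators $D-x_b\bigl(u+N+1-2b+\eta\bigr)$ over $b=N+2-a,\dots,N+1$, with $b$ increasing from the left to the right. Let $w_1,\dots,w_{N+1}$ be a basis of the solutions on $\Omega$ of $L(u)w(u)=0$, over the functions on $\Omega$ with period $2$, such that $L_a(u)w_b(u)=0$ on $\Omega$ for $1\le b\le a\le N+1$. Put $$[i_0,\dots,i_N]=\det\bigl(w_b(u+2i_k)\bigr)_{1\le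 b\le N+1,\;0\le k\le N}.$$ **Lemma.** Let $0=i_0<i_1<\dots<i_N$ be integers, let $\mu$ be the Young diagram with rows $\mu_k=i_{N+1-k}+k-N-1$ $(1\le k\le N+1)$, and let $\mu'$ be its transpose. Give the boxes of the skew diagram $(\mu_1^{N+1})/\mu$ (English convention) the coordinates $(j,k)$, where the row index $j$ increases upwards, the column index $k$ increases from the left to the right, and $(1,1)$ is the bottom left corner. Then for every $u\in\Omega$ one has $[0,1,\dots,N]\neq0$ and $$\frac{[i_0,i_1,\dots,i_N]}{[0,1,\dots,N]}=\sum_b\ \prod_{(j,k)\in(\mu_1^{N+1})/\mu}x_{b(j,k)}(u+2j+2k-4)=\det_{1\le j,k\le\mu_1}\Bigl(T^{\mu'_j-j+k}\bigl(u+N-1+j+k-\mu'_j+\eta\bigr)\Bigr),$$ where $b$ runs over the semistandard tableaux on $(\mu_1^{N+1})/\mu$ with entries in $\{1,\dots,N+1\}$: entries weakly increase along each row from the left to the right and strictly increase down each column. -/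

import Mathlib

noncomputable section

namespace TwistedA

/-! ### Difference operators in the shift `D`, `D f(u) = f(u + 2) D` -/

/-- `D ^ k` acts on functions of `u` by `f(u) ↦ f(u + 2k)`.  Through this action, the generator `X`
of `SkewPolynomial (ℂ → ℂ)` satisfies `X * f(u) = f(u + 2) * X`, so it is the operator `D`. -/
instance shiftAction : MulSemiringAction (Multiplicative ℕ) (ℂ → ℂ) where
  smul k f := fun u => f (u + 2 * ((Multiplicative.toAdd k : ℕ) : ℂ))
  one_smul f := by
    funext u
    change f (u + 2 * ((0 : ℕ) : ℂ)) = f u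
    simp
  mul_smul k l f := by
    funext u
    change f (u + 2 * ((Multiplicative.toAdd k + Multiplicative.toAdd l : ℕ) : ℂ))
      = f (u + 2 * ((Multiplicative.toAdd k : ℕ) : ℂ) + 2 * ((Multiplicative.toAdd l : ℕ) : ℂ))
    congr 1
    push_cast
    ring
  smul_zero _ := rfl
  smul_add _ _ _ := rfl
  smul_one _ := rfl
  smul_mul _ _ _ := rfl

theorem shift_smul_apply (k : Multiplicative ℕ) (f : ℂ → ℂ) (u : ℂ) :
    (k • f) u = f (u + 2 * ((Multiplicative.toAdd k : ℕ) : ℂ)) := rfl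

/-- Difference operators `∑ₖ gₖ(u) Dᵏ`, with composition as multiplication. -/
abbrev DiffOp := SkewPolynomial (ℂ → ℂ)

/-- The operator `D`. -/
def shiftOp : DiffOp := SkewPolynomial.X

/-- The operator of multiplication by a function. -/
def mulOp (g : ℂ → ℂ) : DiffOp := SkewPolynomial.C g

/-- The function `P(u) f(u) = ∑ₖ gₖ(u) f(u + 2k)` for `P(u) = ∑ₖ gₖ(u) Dᵏ`. -/
def applyOp (P : DiffOp) (f : ℂ → ℂ) : ℂ → ℂ :=
  fun u => P.sum fun k g => g u * f (u + 2 * (k : ℂ))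

/-! ### The variables of type `A_N^{(2)}`

`N = 2n` or `N = 2n - 1`, that is, `n = (N + 1) / 2` with integer division. -/

/-- The shift `π i / (2ħ)`.  For `ħ = 0` it is `0`, which is the formal specialisation
`π i / ħ = 0` of the theory. -/
def halfPeriod (ħ : ℂ) : ℂ := (Real.pi : ℂ) * Complex.I / (2 * ħ)

/-- `Y₀(u) = 1` and `Y_a(u) = Q_a(u - 1) / Q_a(u + 1)`. -/
def Y (Q : ℕ → ℂ → ℂ) (a : ℕ) (u : ℂ) : ℂ :=
  if a = 0 then 1 else Q a (u - 1) / Q a (u + 1)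

/-- `Y_a²(u) = Y_a(u) Y_a(u + π i / (2ħ))`, where the superscript is not a power. -/
def Y2 (ħ : ℂ) (Q : ℕ → ℂ → ℂ) (a : ℕ) (u : ℂ) : ℂ :=
  Y Q a u * Y Q a (u + halfPeriod ħ)

/-- The variables `x_a(u)`, `1 ≤ a ≤ 2n + 1`, for `A_{2n}^{(2)}`. -/
def xEven (n : ℕ) (ħ : ℂ) (Q : ℕ → ℂ → ℂ) (a : ℕ) (u : ℂ) : ℂ :=
  if a ≤ n then
    Y Q a (u + a) / Y Q (a - 1) (u + a + 1)
  else if a = n + 1 then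
    Y Q n (u + n + 1 + halfPeriod ħ) / Y Q n (u + n + 2)
  else
    let d : ℕ := 2 * n + 2 - a
    Y Q (d - 1) (u + 2 * n - d + 2 + halfPeriod ħ) / Y Q d (u + 2 * n - d + 3 + halfPeriod ħ)

/-- The variables `x_a(u)`, `1 ≤ a ≤ 2n`, for `A_{2n-1}^{(2)}`. -/
def xOdd (n : ℕ) (ħ : ℂ) (Q : ℕ → ℂ → ℂ) (a : ℕ) (u : ℂ) : ℂ :=
  if a < n then
    Y Q a (u + a) / Y Q (a - 1) (u + a + 1)
  else if a = n then
    Y2 ħ Q n (u + n) / Y Q (n - 1) (u + n + 1)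
  else if a = n + 1 then
    Y Q (n - 1) (u + n + 1 + halfPeriod ħ) / Y2 ħ Q n (u + n + 2)
  else
    let d : ℕ := 2 * n + 1 - a
    Y Q (d - 1) (u + 2 * n - d + 1 + halfPeriod ħ) / Y Q d (u + 2 * n - d + 2 + halfPeriod ħ)

/-- The variables `x_a(u)`, `1 ≤ a ≤ N + 1`, for `A_N^{(2)}`. -/
def x (N : ℕ) (ħ : ℂ) (Q : ℕ → ℂ → ℂ) (a : ℕ) (u : ℂ) : ℂ :=
  if Even N then xEven ((N + 1) / 2) ħ Q a u else xOdd ((N + 1) / 2) ħ Q a u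

/-! ### The operator `L(u)`, its coefficients and its right factors -/

/-- `L(u) = (1 - x_{N+1}(u) D) (1 - x_N(u) D) ⋯ (1 - x_1(u) D)`. -/
def L (N : ℕ) (ħ : ℂ) (Q : ℕ → ℂ → ℂ) : DiffOp :=
  ((List.range (N + 1)).map fun r => 1 - mulOp (x N ħ Q (N + 1 - r)) * shiftOp).prod

/-- The functions `T^a(u)`, `a ∈ ℤ`: `L(u) = ∑_{a ≥ 0} (-1)^a T^a(u + a) D^a` and `T^a = 0` for
`a < 0`. -/
def T (N : ℕ) (ħ : ℂ) (Q : ℕ → ℂ → ℂ) (a : ℤ) (u : ℂ) : ℂ :=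
  if a < 0 then 0
  else (-1) ^ a.toNat * SkewPolynomial.coeff (L N ħ Q) a.toNat (u - a)

/-- `L_a(u)`, `1 ≤ a ≤ N + 1`, is the product, for `b` increasing from `N + 2 - a` to `N + 1` from
the left to the right, of the operators `D - x_b(u + N + 1 - 2b + π i / (2ħ))`. -/
def Lpart (N : ℕ) (ħ : ℂ) (Q : ℕ → ℂ → ℂ) (a : ℕ) : DiffOp :=
  ((List.range' (N + 2 - a) a).map fun b : ℕ =>
    shiftOp - mulOp fun u : ℂ => x N ħ Q b (u + N + 1 - 2 * b + halfPeriod ħ)).prod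

/-! ### Solutions and Casorati determinants -/

/-- `w` is a basis of the solutions on `Ω` of `L(u) w(u) = 0`, over the functions on `Ω` with
period `2`. -/
structure IsSolutionBasis (N : ℕ) (ħ : ℂ) (Q : ℕ → ℂ → ℂ) (Ω : Set ℂ)
    (w : Fin (N + 1) → ℂ → ℂ) : Prop where
  solution : ∀ b, ∀ u ∈ Ω, applyOp (L N ħ Q) (w b) u = 0
  independent : ∀ p : Fin (N + 1) → ℂ → ℂ,
    (∀ b, ∀ u ∈ Ω, p b (u + 2) = p b u) →
    (∀ u ∈ Ω, ∑ b, p b u * w b u = 0) → ∀ b, ∀ u ∈ Ω, p b u = 0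
  spanning : ∀ f : ℂ → ℂ, (∀ u ∈ Ω, applyOp (L N ħ Q) f u = 0) →
    ∃ p : Fin (N + 1) → ℂ → ℂ,
      (∀ b, ∀ u ∈ Ω, p b (u + 2) = p b u) ∧ ∀ u ∈ Ω, f u = ∑ b, p b u * w b u

/-- The Casorati determinant `[i_0, …, i_N]` as a function of `u`. -/
def casorati {N : ℕ} (w : Fin (N + 1) → ℂ → ℂ) (i : Fin (N + 1) → ℕ) (u : ℂ) : ℂ :=
  (Matrix.of fun b k : Fin (N + 1) => w b (u + 2 * (i k : ℂ))).det

/-! ### Young diagrams and tableaux -/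

/-- The number `i_{N-r} - (N - r)`, which is `μ_k = i_{N+1-k} + k - N - 1` for `k = r + 1`; it is
`0` for `r > N`. -/
def part {N : ℕ} (i : Fin (N + 1) → ℕ) (r : ℕ) : ℕ :=
  if r ≤ N then i ⟨N - r, by omega⟩ - (N - r) else 0

theorem le_of_strictMono {N : ℕ} {i : Fin (N + 1) → ℕ} (hi : StrictMono i) (k : Fin (N + 1)) :
    (k : ℕ) ≤ i k := by
  obtain ⟨k, hk⟩ := k
  induction k with
  | zero => exact Nat.zero_le _
  | succ k ih =>
    have h1 := ih (by omega)
    have h2 : i ⟨k, by omega⟩ < i ⟨k + 1, hk⟩ := hi (by simp [Fin.lt_def])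
    simp only at h1 ⊢
    omega

theorem part_antitone {N : ℕ} {i : Fin (N + 1) → ℕ} (hi : StrictMono i) : Antitone (part i) := by
  apply antitone_nat_of_succ_le
  intro r
  unfold part
  by_cases h : r + 1 ≤ N
  · have h2 : i ⟨N - (r + 1), by omega⟩ < i ⟨N - r, by omega⟩ := hi (by simp [Fin.lt_def]; omega)
    rw [if_pos h, if_pos (by omega)]
    omega
  · rw [if_neg h]
    exact Nat.zero_le _

/-- The Young diagram `μ` with rows `μ_k = i_{N+1-k} + k - N - 1`, `1 ≤ k ≤ N + 1`.  Mathlib numbers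
the rows and the columns of a Young diagram from `0`, in the English convention. -/
def diagram {N : ℕ} (i : Fin (N + 1) → ℕ) (hi : StrictMono i) : YoungDiagram where
  cells := (Finset.range (N + 1) ×ˢ Finset.range (part i 0)).filter fun c => c.2 < part i c.1
  isLowerSet := by
    rintro ⟨r, c⟩ ⟨r', c'⟩ h hm
    obtain ⟨h1, h2⟩ := Prod.mk_le_mk.mp h
    have := part_antitone hi h1
    simp only [Finset.coe_filter, Finset.mem_product, Finset.mem_range, Set.mem_ofPred_eq] at hm ⊢
    omega

theorem rowLen_diagram {N : ℕ} (i : Fin (N + 1) → ℕ) (hi : StrictMono i) (k : ℕ) (hk : k ≤ N) :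
    ((diagram i hi).rowLen k : ℤ) = i ⟨N - k, by omega⟩ + (k + 1) - N - 1 := by
  have hmem : ∀ c, c < (diagram i hi).rowLen k ↔ c < part i k := by
    intro c
    rw [← YoungDiagram.mem_iff_lt_rowLen, ← YoungDiagram.mem_cells]
    have := part_antitone hi (Nat.zero_le k)
    simp only [diagram, Finset.mem_filter, Finset.mem_product, Finset.mem_range]
    omega
  have heq : (diagram i hi).rowLen k = part i k := by
    have h1 := hmem ((diagram i hi).rowLen k)
    have h2 := hmem (part i k)
    omega
  have h3 := le_of_strictMono hi ⟨N - k, by omega⟩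
  rw [heq, part, if_pos hk]
  simp only at h3
  omega

/-- The coordinates `(j, k)` of the boxes of the skew diagram `(μ_1^R) / μ`, where `μ` has at most
`R` rows: `j` is the number of the row counted from the bottom, `k` the number of the column
counted from the left, both starting from `1`. -/
def skewCells (R : ℕ) (μ : YoungDiagram) : Finset (ℕ × ℕ) :=
  (Finset.Icc 1 R ×ˢ Finset.Icc 1 (μ.rowLen 0)).filter fun c => (R - c.1, c.2 - 1) ∉ μ

/-- Fillings of `(μ_1^R) / μ` by elements of `{1, …, R}`. -/
abbrev Filling (R : ℕ) (μ : YoungDiagram) : Type := skewCells R μ → Finset.Icc 1 R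

/-- The entries weakly increase along the rows from the left to the right and strictly increase down
the columns (the coordinate `j` increases as one goes up). -/
def IsSemistandard {R : ℕ} {μ : YoungDiagram} (b : Filling R μ) : Prop :=
  (∀ c d : skewCells R μ, c.1.1 = d.1.1 → c.1.2 ≤ d.1.2 → (b c : ℕ) ≤ b d) ∧
  (∀ c d : skewCells R μ, c.1.2 = d.1.2 → c.1.1 < d.1.1 → (b d : ℕ) < b c)

open Classical in
/-- The set of semistandard tableaux on `(μ_1^R) / μ` with entries in `{1, …, R}`. -/
def semistandardTableaux (R : ℕ) (μ : YoungDiagram) : Finset (Filling R μ) :=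
  Finset.univ.filter IsSemistandard

/-- `∑_b ∏_{(j,k)} x_{b(j,k)}(u + 2j + 2k - 4)`, over the semistandard tableaux `b` on
`(μ_1^{N+1}) / μ`. -/
def tableauSum (N : ℕ) (ħ : ℂ) (Q : ℕ → ℂ → ℂ) (μ : YoungDiagram) (u : ℂ) : ℂ :=
  ∑ b ∈ semistandardTableaux (N + 1) μ, ∏ c : skewCells (N + 1) μ,
    x N ħ Q (b c) (u + 2 * (c.1.1 : ℂ) + 2 * (c.1.2 : ℂ) - 4)

/-- The determinant of the matrix with entries
`T^{μ'_j - j + k}(u + N - 1 + j + k - μ'_j + π i / (2ħ))`, `1 ≤ j, k ≤ μ_1`. -/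
def jacobiTrudi (N : ℕ) (ħ : ℂ) (Q : ℕ → ℂ → ℂ) (μ : YoungDiagram) (u : ℂ) : ℂ :=
  (Matrix.of fun j k : Fin (μ.rowLen 0) =>
    T N ħ Q ((μ.transpose.rowLen j : ℤ) - ((j : ℤ) + 1) + ((k : ℤ) + 1))
      (u + N - 1 + ((j : ℂ) + 1) + ((k : ℂ) + 1) - (μ.transpose.rowLen j : ℂ)
        + halfPeriod ħ)).det

end TwistedA

end

/-! Write `e_a(u)` for the coefficient of `(-1)^a D^a` in `L(u)`, and `η` for the half period. Both
expressions on the right equal the determinant `det (e_{c_j - k}(u + 2k))`, `0 ≤ j, k < μ_1`, where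
`c_j = N + 1 - μ'_{j+1} + j` runs through the complement of `{i_0, …, i_N}` in `{0, …, N + μ_1}`.

Duality. In the form `x_a(u) = y_a(u + a) / y_{a-1}(u + a + 1)`, the variables satisfy `y_0 =
y_{N+1} = 1` and `y_{N+1-a}(u + η) = y_a(u)`. This symmetry gives `e_a(u) = e_{N+1-a}(u - (N + 1) +
2a + η)` (`esym_duality`). It turns the determinant into the one with the functions `T^a`, and gives
`e_{N+1} = 1`.

Casorati determinants. Thus `L(u) w(u) = 0` is a recurrence of order `N + 1` whose outer
coefficients are `±1`, so a solution is determined on `u + 2ℤ` by `N + 1` consecutive values and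
`[0, …, N]` cannot vanish. Applying the recurrence at `u, u + 2, …` gives a banded matrix
annihilating the table of values of the `w_b`. Jacobi's theorem on complementary minors expresses
the ratio as a minor of the banded matrix (`casorati_det_eq_jtDet_mul`).

Tableaux. Removing the rightmost factor of the product, which has the smallest label, splits each
row of the determinant into two terms. By multilinearity it becomes a sum over the sets of columns
containing that label; the choices that break semistandardness give two equal rows or a zero row.
Induction yields the tableau sum, with no cancellation left to treat
(`jtDet_eq_sum_columnFamilies`). -/

noncomputable section

namespace TwistedA

/-! ### Coefficients of products of first order operators -/

/-- The coefficient of `D ^ a` in `(1 + x_{t+s}(u) D) ⋯ (1 + x_{t+1}(u) D)`. -/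
def esym (x : ℕ → ℂ → ℂ) (t : ℕ) : ℕ → ℤ → ℂ → ℂ
  | 0, a, _ => if a = 0 then 1 else 0
  | s + 1, a, u => esym x t s a u + x (t + s + 1) u * esym x t s (a - 1) (u + 2)

theorem esym_of_neg (x : ℕ → ℂ → ℂ) (t s : ℕ) {a : ℤ} (ha : a < 0) (u : ℂ) :
    esym x t s a u = 0 := by
  induction s generalizing a u with
  | zero => simp [esym, ha.ne]
  | succ s ih => simp [esym, ih ha, ih (show a - 1 < 0 by omega)]

theorem esym_of_lt (x : ℕ → ℂ → ℂ) (t s : ℕ) {a : ℤ} (ha : (s : ℤ) < a) (u : ℂ) :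
    esym x t s a u = 0 := by
  induction s generalizing a u with
  | zero => simp [esym, show a ≠ 0 by intro h; simp [h] at ha]
  | succ s ih =>
    push_cast at ha
    simp [esym, ih (show (s : ℤ) < a by omega), ih (show (s : ℤ) < a - 1 by omega)]

theorem esym_zero (x : ℕ → ℂ → ℂ) (t s : ℕ) (u : ℂ) : esym x t s 0 u = 1 := by
  induction s generalizing u with
  | zero => simp [esym]
  | succ s ih => simp [esym, ih, esym_of_neg]

/-- Expansion with respect to the rightmost factor. -/
theorem esym_succ_right (x : ℕ → ℂ → ℂ) (t s : ℕ) (a : ℤ) (u : ℂ) :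
    esym x t (s + 1) a u =
      esym x (t + 1) s a u + x (t + 1) (u + 2 * ((a : ℂ) - 1)) * esym x (t + 1) s (a - 1) u := by
  induction s generalizing a u with
  | zero =>
    simp only [esym]
    by_cases h : a - 1 = 0
    · obtain rfl : a = 1 := by omega
      simp
    · simp [h]
  | succ s ih =>
    rw [esym, ih, ih, esym, esym, show t + 1 + s + 1 = t + (s + 1) + 1 by ring]
    rw [show u + 2 + 2 * (((a - 1 : ℤ) : ℂ) - 1) = u + 2 * ((a : ℂ) - 1) by push_cast; ring]
    ring

theorem coeff_sub (P P' : DiffOp) (k : ℕ) :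
    SkewPolynomial.coeff (P - P') k = SkewPolynomial.coeff P k - SkewPolynomial.coeff P' k := by
  simp [SkewPolynomial.coeff]

theorem coeff_monomial_one_mul (f : ℂ → ℂ) (P : DiffOp) (k : ℕ) (u : ℂ) :
    SkewPolynomial.coeff (mulOp f * shiftOp * P) (k + 1) u
      = f u * SkewPolynomial.coeff P k (u + 2) := by
  have h : mulOp f * shiftOp = SkewMonoidAlgebra.single (Multiplicative.ofAdd 1) f := by
    rw [mulOp, shiftOp, ← SkewPolynomial.monomial_zero_left, SkewPolynomial.monomial_mul_X]
    rfl
  have h2 := SkewMonoidAlgebra.coeff_single_mul_aux P (r := f) (x := Multiplicative.ofAdd 1)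
    (y := Multiplicative.ofAdd (k + 1)) (z := Multiplicative.ofAdd k) (by
      rw [add_comm k 1, ofAdd_add]
      exact fun _ => mul_right_inj (Multiplicative.ofAdd 1 : Multiplicative ℕ))
  rw [h]
  simp only [SkewPolynomial.coeff]
  rw [h2]
  change f u * (Multiplicative.ofAdd 1 • _ : ℂ → ℂ) u = _
  rw [shift_smul_apply]
  simp

theorem coeff_monomial_one_mul_zero (f : ℂ → ℂ) (P : DiffOp) :
    SkewPolynomial.coeff (mulOp f * shiftOp * P) 0 = 0 := by
  have h : mulOp f * shiftOp = SkewMonoidAlgebra.single (Multiplicative.ofAdd 1) f := by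
    rw [mulOp, shiftOp, ← SkewPolynomial.monomial_zero_left, SkewPolynomial.monomial_mul_X]
    rfl
  rw [h]
  apply SkewMonoidAlgebra.coeff_single_mul_of_not_exists_mul
  rintro ⟨d, hd⟩
  have := congrArg Multiplicative.toAdd hd
  simp at this
  omega

theorem coeff_prod_range (x : ℕ → ℂ → ℂ) (s k : ℕ) (u : ℂ) :
    SkewPolynomial.coeff
      (((List.range s).map fun r => (1 - mulOp (x (s - r)) * shiftOp : DiffOp)).prod) k u
      = (-1) ^ k * esym x 0 s k u := by
  induction s generalizing k u with
  | zero =>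
    rcases k with _ | k
    · simp [esym]
    · rw [esym_of_lt _ _ _ (by push_cast; omega), List.range_zero, List.map_nil, List.prod_nil,
        SkewPolynomial.coeff_one, if_neg (by omega), mul_zero]
      rfl
  | succ s ih =>
    rw [List.range_succ_eq_map, List.map_cons, List.prod_cons, List.map_map]
    have h2 : ((fun r => (1 - mulOp (x (s + 1 - r)) * shiftOp : DiffOp)) ∘ Nat.succ)
        = fun r => 1 - mulOp (x (s - r)) * shiftOp := by
      funext r
      simp [Nat.succ_eq_add_one]
    rw [h2, Nat.sub_zero, sub_mul, one_mul, coeff_sub, Pi.sub_apply, ih]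
    rcases k with _ | k
    · rw [coeff_monomial_one_mul_zero]
      simp [esym, esym_of_neg]
    · rw [coeff_monomial_one_mul, ih, esym]
      rw [show ((k + 1 : ℕ) : ℤ) - 1 = k by push_cast; ring, Nat.zero_add]
      ring

theorem coeff_L (N : ℕ) (ħ : ℂ) (Q : ℕ → ℂ → ℂ) (k : ℕ) (u : ℂ) :
    SkewPolynomial.coeff (L N ħ Q) k u = (-1) ^ k * esym (x N ħ Q) 0 (N + 1) k u :=
  coeff_prod_range _ _ _ _

theorem T_eq_esym (N : ℕ) (ħ : ℂ) (Q : ℕ → ℂ → ℂ) (a : ℤ) (u : ℂ) :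
    T N ħ Q a u = esym (x N ħ Q) 0 (N + 1) a (u - a) := by
  rw [T]
  split_ifs with h
  · rw [esym_of_neg _ _ _ h]
  · lift a to ℕ using by omega
    rw [Int.toNat_natCast, coeff_L, ← mul_assoc, ← mul_pow]
    simp

theorem applyOp_L (N : ℕ) (ħ : ℂ) (Q : ℕ → ℂ → ℂ) (f : ℂ → ℂ) (u : ℂ) :
    applyOp (L N ħ Q) f u = ∑ k ∈ Finset.range (N + 2),
      (-1) ^ k * esym (x N ħ Q) 0 (N + 1) k u * f (u + 2 * (k : ℂ)) := by
  rw [applyOp, SkewPolynomial.sum_def]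
  simp only [coeff_L]
  apply Finset.sum_subset_zero_on_sdiff
  · intro k hk
    rw [SkewPolynomial.mem_support_iff] at hk
    by_contra h
    apply hk
    funext v
    rw [coeff_L, esym_of_lt]
    · simp
    · simp at h
      push_cast
      omega
  · intro k hk
    simp only [Finset.mem_sdiff, SkewPolynomial.mem_support_iff, not_not] at hk
    rw [← coeff_L, hk.2]
    simp
  · simp

/-! ### The variables in a uniform notation, and the duality -/

/-- The functions `y_a` with `x_a(u) = y_a(u + a) / y_{a-1}(u + a + 1)`. -/
def y (N : ℕ) (ħ : ℂ) (Q : ℕ → ℂ → ℂ) (a : ℕ) (u : ℂ) : ℂ :=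
  if 2 * a < N + 1 then Y Q a u
  else if 2 * a = N + 1 then Y2 ħ Q a u
  else Y Q (N + 1 - a) (u + halfPeriod ħ)

/-- One formula for both parities: past the middle, `y_a` continues as `Y_{N+1-a}` shifted by the
half period, and for odd `N` the middle node carries the product `Y2`. -/
theorem x_eq_div (N : ℕ) (ħ : ℂ) (Q : ℕ → ℂ → ℂ) (hN : 2 ≤ N) {a : ℕ} (ha : 1 ≤ a)
    (haN : a ≤ N + 1) (u : ℂ) :
    x N ħ Q a u = y N ħ Q a (u + a) / y N ħ Q (a - 1) (u + a + 1) := by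
  rw [x]
  split_ifs with h
  · obtain ⟨n, hn⟩ := h
    obtain rfl : N = 2 * n := by omega
    rw [show (2 * n + 1) / 2 = n by omega, xEven]
    split_ifs with h1 h2
    · rw [y, if_pos (by omega), y, if_pos (by omega)]
    · subst h2
      rw [y, if_neg (by omega), if_neg (by omega), y, if_pos (by omega)]
      rw [show 2 * n + 1 - (n + 1) = n by omega, Nat.add_sub_cancel]
      push_cast
      congr 2 <;> ring
    · rw [y, if_neg (by omega), if_neg (by omega), y, if_neg (by omega), if_neg (by omega)]
      obtain ⟨d, hd⟩ : ∃ d, 2 * n + 2 = a + d := ⟨2 * n + 2 - a, by omega⟩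
      have hd' : (a : ℂ) = 2 * n + 2 - d := by
        rw [eq_sub_iff_add_eq]; exact_mod_cast hd.symm
      rw [show 2 * n + 2 - a = d by omega, show 2 * n + 1 - a = d - 1 by omega,
        show 2 * n + 1 - (a - 1) = d by omega, hd']
      ring_nf
  · obtain ⟨n, hn⟩ : ∃ n, N = 2 * n + 1 := by
      obtain ⟨n, hn⟩ := Nat.not_even_iff_odd.mp h
      exact ⟨n, hn⟩
    subst hn
    rw [show (2 * n + 1 + 1) / 2 = n + 1 by omega, xOdd]
    split_ifs with h1 h2 h3
    · rw [y, if_pos (by omega), y, if_pos (by omega)]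
    · subst h2
      rw [y, if_neg (by omega), if_pos (by omega), y, if_pos (by omega)]
    · subst h3
      rw [y, if_neg (by omega), if_neg (by omega), y, if_neg (by omega), if_pos (by omega)]
      rw [show 2 * n + 1 + 1 - (n + 1 + 1) = n + 1 - 1 by omega, Nat.add_sub_cancel]
      push_cast
      congr 2 <;> ring
    · rw [y, if_neg (by omega), if_neg (by omega), y, if_neg (by omega), if_neg (by omega)]
      obtain ⟨d, hd⟩ : ∃ d, 2 * n + 3 = a + d := ⟨2 * n + 3 - a, by omega⟩
      have hd' : (a : ℂ) = 2 * n + 3 - d := by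
        rw [eq_sub_iff_add_eq]; exact_mod_cast hd.symm
      rw [show 2 * (n + 1) + 1 - a = d by omega, show 2 * n + 1 + 1 - a = d - 1 by omega,
        show 2 * n + 1 + 1 - (a - 1) = d by omega, hd']
      push_cast
      congr 2 <;> ring

theorem y_zero (N : ℕ) (ħ : ℂ) (Q : ℕ → ℂ → ℂ) (u : ℂ) : y N ħ Q 0 u = 1 := by
  simp [y, Y]

theorem y_last (N : ℕ) (ħ : ℂ) (Q : ℕ → ℂ → ℂ) (u : ℂ) : y N ħ Q (N + 1) u = 1 := by
  rw [y, if_neg (by omega), if_neg (by omega)]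
  simp [Y]

/-! ### Symmetry and nonvanishing on `Ω`, and the duality. -/

section Domain

variable {N : ℕ} {ħ : ℂ} {Q : ℕ → ℂ → ℂ} {Ω : Set ℂ}

theorem Y_ne_zero (hΩ : ∀ u ∈ Ω, ∀ r s : ℤ, u + r + s * halfPeriod ħ ∈ Ω)
    (hQ : ∀ a : ℕ, 1 ≤ a → a ≤ (N + 1) / 2 → ∀ u ∈ Ω, Q a u ≠ 0)
    {a : ℕ} (ha : a ≤ (N + 1) / 2) {u : ℂ} (hu : u ∈ Ω) : Y Q a u ≠ 0 := by
  rw [Y]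
  split_ifs with h
  · exact one_ne_zero
  · have h1 := hQ a (by omega) ha _ (by simpa using hΩ u hu (-1) 0)
    have h2 := hQ a (by omega) ha _ (by simpa using hΩ u hu 1 0)
    rw [← sub_eq_add_neg] at h1
    exact div_ne_zero h1 h2

/-- The multiplier of `Q_a` cancels in the quotient; it is nonzero because `Q_a` has no zeros on
`Ω`. Division by zero makes both periods `0` when `ħ = 0`, so that case needs no separate treatment.
-/
theorem Y_periodic (hΩ : ∀ u ∈ Ω, ∀ r s : ℤ, u + r + s * halfPeriod ħ ∈ Ω)
    (hQ : ∀ a : ℕ, 1 ≤ a → a ≤ (N + 1) / 2 → ∀ u ∈ Ω, Q a u ≠ 0)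
    (hper : ∀ a : ℕ, 1 ≤ a → a ≤ (N + 1) / 2 →
      ∃ h : ℂ, ∀ u ∈ Ω, Q a (u + (Real.pi : ℂ) * Complex.I / ħ) = h * Q a u)
    {a : ℕ} (ha : a ≤ (N + 1) / 2) {u : ℂ} (hu : u ∈ Ω) :
    Y Q a (u + halfPeriod ħ + halfPeriod ħ) = Y Q a u := by
  rw [Y, Y]
  split_ifs with h0
  · rfl
  · obtain ⟨h, hh⟩ := hper a (by omega) ha
    have hp : halfPeriod ħ + halfPeriod ħ = (Real.pi : ℂ) * Complex.I / ħ := by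
      rw [halfPeriod, mul_comm 2 ħ, ← div_div, add_halves]
    have m1 : u - 1 ∈ Ω := by simpa [← sub_eq_add_neg] using hΩ u hu (-1) 0
    have m2 : u + 1 ∈ Ω := by simpa using hΩ u hu 1 0
    have e1 := hh _ m1
    have e2 := hh _ m2
    rw [← hp] at e1 e2
    have hh0 : h ≠ 0 := by
      rintro rfl
      apply hQ a (by omega) ha (u + 1 + (halfPeriod ħ + halfPeriod ħ))
      · have := hΩ _ m2 0 2
        push_cast at this
        rwa [add_zero, two_mul] at this
      · rw [e2, zero_mul]
    rw [show u + halfPeriod ħ + halfPeriod ħ - 1 = u - 1 + (halfPeriod ħ + halfPeriod ħ) by ring,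
      show u + halfPeriod ħ + halfPeriod ħ + 1 = u + 1 + (halfPeriod ħ + halfPeriod ħ) by ring,
      e1, e2, mul_div_mul_left _ _ hh0]

theorem add_halfPeriod_mem (hΩ : ∀ u ∈ Ω, ∀ r s : ℤ, u + r + s * halfPeriod ħ ∈ Ω)
    {u : ℂ} (hu : u ∈ Ω) : u + halfPeriod ħ ∈ Ω := by
  simpa using hΩ u hu 0 1

theorem add_intCast_mem (hΩ : ∀ u ∈ Ω, ∀ r s : ℤ, u + r + s * halfPeriod ħ ∈ Ω)
    {u : ℂ} (hu : u ∈ Ω) (r : ℤ) : u + r ∈ Ω := by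
  simpa using hΩ u hu r 0

theorem y_ne_zero (hΩ : ∀ u ∈ Ω, ∀ r s : ℤ, u + r + s * halfPeriod ħ ∈ Ω)
    (hQ : ∀ a : ℕ, 1 ≤ a → a ≤ (N + 1) / 2 → ∀ u ∈ Ω, Q a u ≠ 0)
    (a : ℕ) {u : ℂ} (hu : u ∈ Ω) : y N ħ Q a u ≠ 0 := by
  rw [y]
  split_ifs
  · exact Y_ne_zero hΩ hQ (by omega) hu
  · exact mul_ne_zero (Y_ne_zero hΩ hQ (by omega) hu)
      (Y_ne_zero hΩ hQ (by omega) (add_halfPeriod_mem hΩ hu))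
  · exact Y_ne_zero hΩ hQ (by omega) (add_halfPeriod_mem hΩ hu)

/-- The reflection `a ↦ N + 1 - a` exchanges the outer branches of `y` and fixes the middle one.
Where two half periods accumulate, they disappear by the periodicity of `Y_a`. -/
theorem y_sub (hΩ : ∀ u ∈ Ω, ∀ r s : ℤ, u + r + s * halfPeriod ħ ∈ Ω)
    (hQ : ∀ a : ℕ, 1 ≤ a → a ≤ (N + 1) / 2 → ∀ u ∈ Ω, Q a u ≠ 0)
    (hper : ∀ a : ℕ, 1 ≤ a → a ≤ (N + 1) / 2 →
      ∃ h : ℂ, ∀ u ∈ Ω, Q a (u + (Real.pi : ℂ) * Complex.I / ħ) = h * Q a u)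
    {a : ℕ} (ha : a ≤ N + 1) {u : ℂ} (hu : u ∈ Ω) :
    y N ħ Q (N + 1 - a) (u + halfPeriod ħ) = y N ħ Q a u := by
  rcases lt_trichotomy (2 * a) (N + 1) with h | h | h
  · rw [y, if_neg (by omega), if_neg (by omega), y, if_pos h, Nat.sub_sub_self ha,
      Y_periodic hΩ hQ hper (by omega) hu]
  · rw [y, if_neg (by omega), if_pos (by omega), y, if_neg (by omega), if_pos h,
      show N + 1 - a = a by omega, Y2, Y2, Y_periodic hΩ hQ hper (by omega) hu, mul_comm]
  · rw [y, if_pos (by omega), y, if_neg (by omega), if_neg (by omega)]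

/-- Comparison of the two factorizations of `L(u)`, by induction on the number of factors. -/
theorem esym_partial_duality (hN : 2 ≤ N) (hΩ : ∀ u ∈ Ω, ∀ r s : ℤ, u + r + s * halfPeriod ħ ∈ Ω)
    (hQ : ∀ a : ℕ, 1 ≤ a → a ≤ (N + 1) / 2 → ∀ u ∈ Ω, Q a u ≠ 0)
    (hper : ∀ a : ℕ, 1 ≤ a → a ≤ (N + 1) / 2 →
      ∃ h : ℂ, ∀ u ∈ Ω, Q a (u + (Real.pi : ℂ) * Complex.I / ħ) = h * Q a u)
    {s : ℕ} (hs : s ≤ N + 1) (a : ℤ) {u : ℂ} (hu : u ∈ Ω) :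
    esym (x N ħ Q) 0 s a u = y N ħ Q s (u + s) *
      esym (x N ħ Q) (N + 1 - s) s (s - a) (u - (N + 1) + 2 * a + halfPeriod ħ) := by
  induction s generalizing a u with
  | zero =>
    simp only [esym, y_zero, one_mul, Nat.cast_zero, zero_sub, neg_eq_zero]
  | succ s ih =>
    have hu2 : u + 2 ∈ Ω := by simpa using add_intCast_mem hΩ hu 2
    have hus : u + s ∈ Ω := by simpa using add_intCast_mem hΩ hu s
    have hus1 : u + (s + 1 : ℕ) ∈ Ω := by simpa using add_intCast_mem hΩ hu (s + 1)
    have hus2 : u + (s + 2 : ℕ) ∈ Ω := by simpa using add_intCast_mem hΩ hu (s + 2)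
    -- The left side loses its leftmost factor, of label `s + 1`, and the right side its rightmost
    -- one, of label `N + 1 - s`. What remains is an identity between the `y`'s, which the
    -- reflection reduces to `y_s` and `y_{s+1}`.
    rw [esym, ih (by omega) a hu, ih (by omega) (a - 1) hu2, esym_succ_right,
      show N + 1 - (s + 1) + 1 = N + 1 - s by omega, Nat.zero_add,
      x_eq_div N ħ Q hN (by omega) hs, x_eq_div N ħ Q hN (by omega) (by omega)]
    have e1 : ((N + 1 - s : ℕ) : ℂ) = N + 1 - s := by
      rw [Nat.cast_sub (by omega)]; push_cast; ring
    have e2 : u - (N + 1) + 2 * (a : ℂ) + halfPeriod ħ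
        + 2 * ((((s + 1 : ℕ) - a : ℤ) : ℂ) - 1) + (N + 1 - s : ℕ) = u + s + halfPeriod ħ := by
      rw [e1]; push_cast; ring
    have e3 : u + 2 - (N + 1) + 2 * ((a - 1 : ℤ) : ℂ) + halfPeriod ħ
        = u - (N + 1) + 2 * (a : ℂ) + halfPeriod ħ := by push_cast; ring
    rw [e2, e3, show N + 1 - s - 1 = N + 1 - (s + 1) by omega, Nat.add_sub_cancel,
      show (s : ℤ) - (a - 1) = (s + 1 : ℕ) - a by push_cast; ring,
      show ((s + 1 : ℕ) : ℤ) - a - 1 = s - a by push_cast; ring,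
      show u + s + halfPeriod ħ + 1 = u + (s + 1 : ℕ) + halfPeriod ħ by push_cast; ring,
      y_sub hΩ hQ hper (by omega) hus, y_sub hΩ hQ hper (by omega) hus1,
      show u + (s + 1 : ℕ) + 1 = u + (s + 2 : ℕ) by push_cast; ring,
      show u + 2 + s = u + (s + 2 : ℕ) by push_cast; ring]
    have n1 := y_ne_zero (N := N) hΩ hQ (s + 1) hus1
    have n2 := y_ne_zero (N := N) hΩ hQ s hus2
    field_simp
    ring

/-- The duality `T^a(u + a) = T^{N+1-a}(u + a + π i / (2ħ))`. -/
theorem esym_duality (hN : 2 ≤ N) (hΩ : ∀ u ∈ Ω, ∀ r s : ℤ, u + r + s * halfPeriod ħ ∈ Ω)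
    (hQ : ∀ a : ℕ, 1 ≤ a → a ≤ (N + 1) / 2 → ∀ u ∈ Ω, Q a u ≠ 0)
    (hper : ∀ a : ℕ, 1 ≤ a → a ≤ (N + 1) / 2 →
      ∃ h : ℂ, ∀ u ∈ Ω, Q a (u + (Real.pi : ℂ) * Complex.I / ħ) = h * Q a u)
    (a : ℤ) {u : ℂ} (hu : u ∈ Ω) :
    esym (x N ħ Q) 0 (N + 1) a u =
      esym (x N ħ Q) 0 (N + 1) (N + 1 - a) (u - (N + 1) + 2 * a + halfPeriod ħ) := by
  rw [esym_partial_duality hN hΩ hQ hper le_rfl a hu, y_last, one_mul, Nat.sub_self]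
  push_cast
  rfl

theorem esym_last (hN : 2 ≤ N) (hΩ : ∀ u ∈ Ω, ∀ r s : ℤ, u + r + s * halfPeriod ħ ∈ Ω)
    (hQ : ∀ a : ℕ, 1 ≤ a → a ≤ (N + 1) / 2 → ∀ u ∈ Ω, Q a u ≠ 0)
    (hper : ∀ a : ℕ, 1 ≤ a → a ≤ (N + 1) / 2 →
      ∃ h : ℂ, ∀ u ∈ Ω, Q a (u + (Real.pi : ℂ) * Complex.I / ħ) = h * Q a u)
    {u : ℂ} (hu : u ∈ Ω) : esym (x N ħ Q) 0 (N + 1) (N + 1) u = 1 := by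
  rw [esym_duality hN hΩ hQ hper _ hu, sub_self, esym_zero]

end Domain

/-! ### Expansion of the determinants over families of column sets -/

/-- The determinant with entries `e_{c_j - k}(u + 2k)`. -/
def jtDet (x : ℕ → ℂ → ℂ) (t s : ℕ) {r : ℕ} (c : Fin r → ℤ) (u : ℂ) : ℂ :=
  (Matrix.of fun j k : Fin r => esym x t s (c j - (k : ℕ)) (u + 2 * (k : ℕ))).det

/-- In row `j` the rightmost factor contributes `x_{t+1}` at `u + 2k + 2(c_j - k - 1)`, which does
not depend on the column `k`. It therefore comes out of the row; `S` is the set of rows in which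
this term is chosen. -/
theorem jtDet_succ (x : ℕ → ℂ → ℂ) (t s : ℕ) {r : ℕ} (c : Fin r → ℤ) (u : ℂ) :
    jtDet x t (s + 1) c u = ∑ S : Finset (Fin r), (∏ j ∈ S, x (t + 1) (u + 2 * ((c j : ℂ) - 1))) *
      jtDet x (t + 1) s (fun j => if j ∈ S then c j - 1 else c j) u := by
  have h1 : (Matrix.of fun j k : Fin r => esym x t (s + 1) (c j - (k : ℕ)) (u + 2 * (k : ℕ)))
      = (fun j k : Fin r => x (t + 1) (u + 2 * ((c j : ℂ) - 1)) *
          esym x (t + 1) s (c j - 1 - (k : ℕ)) (u + 2 * (k : ℕ)))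
        + fun j k : Fin r => esym x (t + 1) s (c j - (k : ℕ)) (u + 2 * (k : ℕ)) := by
    funext j k
    simp only [Matrix.of_apply, Pi.add_apply]
    rw [esym_succ_right, add_comm, show c j - (k : ℕ) - 1 = c j - 1 - (k : ℕ) by ring]
    congr 3
    push_cast
    ring
  rw [jtDet, h1]
  refine (AlternatingMap.map_add_univ Matrix.detRowAlternating _ _).trans ?_
  refine Finset.sum_congr rfl fun S _ => ?_
  have h2 : (∏ j ∈ S, x (t + 1) (u + 2 * ((c j : ℂ) - 1)))
      = ∏ j, if j ∈ S then x (t + 1) (u + 2 * ((c j : ℂ) - 1)) else 1 := by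
    rw [Finset.prod_ite_mem, Finset.univ_inter]
  rw [h2, jtDet, ← Matrix.det_mul_column]
  change Matrix.det _ = _
  congr 1
  funext j k
  by_cases hj : j ∈ S <;> simp [hj]

theorem jtDet_eq_zero_of_eq (x : ℕ → ℂ → ℂ) (t s : ℕ) {r : ℕ} (c : Fin r → ℤ) (u : ℂ)
    {j k : Fin r} (hjk : j ≠ k) (h : c j = c k) : jtDet x t s c u = 0 :=
  Matrix.det_zero_of_row_eq hjk (by funext m; simp [h])

theorem jtDet_eq_zero_of_neg (x : ℕ → ℂ → ℂ) (t s : ℕ) {r : ℕ} (c : Fin r → ℤ) (u : ℂ)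
    {j : Fin r} (h : c j < 0) : jtDet x t s c u = 0 :=
  Matrix.det_eq_zero_of_row_eq_zero j fun k => by
    rw [Matrix.of_apply, esym_of_neg _ _ _ (by omega)]

/-- The families of finite sets `B_j` of `l_j` labels from `{t + 1, …, t + s}`, such that for every
`q` the number of the elements of `B_j` above `q` increases weakly with `j`. -/
def columnFamilies (t s : ℕ) {r : ℕ} (l : Fin r → ℕ) : Finset (Fin r → Finset ℕ) :=
  open Classical in
  (Fintype.piFinset fun j => (Finset.Ioc t (t + s)).powersetCard (l j)).filter
    fun B => ∀ q, Monotone fun j => ((B j).filter (q < ·)).card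

theorem mem_columnFamilies {t s r : ℕ} {l : Fin r → ℕ} {B : Fin r → Finset ℕ} :
    B ∈ columnFamilies t s l ↔ (∀ j, B j ⊆ Finset.Ioc t (t + s) ∧ (B j).card = l j) ∧
      ∀ q, Monotone fun j => ((B j).filter (q < ·)).card := by
  simp [columnFamilies, Fintype.mem_piFinset, Finset.mem_powersetCard]

/-- The weight of a set of labels, with the largest label placed at the argument `v`. -/
def columnWeight (x : ℕ → ℂ → ℂ) (A : Finset ℕ) (v : ℂ) : ℂ :=
  ∏ b ∈ A, x b (v + 2 * ((A.filter (b < ·)).card : ℂ))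

theorem columnWeight_insert (x : ℕ → ℂ → ℂ) {A : Finset ℕ} {b : ℕ} (h : ∀ a ∈ A, b < a) (v : ℂ) :
    columnWeight x (insert b A) v = x b (v + 2 * (A.card : ℂ)) * columnWeight x A v := by
  have hb : b ∉ A := fun h' => lt_irrefl _ (h b h')
  rw [columnWeight, Finset.prod_insert hb]
  congr 1
  · rw [Finset.filter_insert, if_neg (lt_irrefl b), Finset.filter_true_of_mem h]
  · refine Finset.prod_congr rfl fun a ha => ?_
    rw [Finset.filter_insert, if_neg (h a ha).not_gt]

theorem columnFamilies_step {t s r : ℕ} {l : Fin r → ℕ} {B : Fin r → Finset ℕ}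
    (hB : B ∈ columnFamilies t (s + 1) l) :
    (fun j => (B j).erase (t + 1)) ∈ columnFamilies (t + 1) s
      (fun j => if t + 1 ∈ B j then l j - 1 else l j) := by
  rw [mem_columnFamilies] at hB ⊢
  obtain ⟨h1, h2⟩ := hB
  refine ⟨fun j => ⟨fun b hb => ?_, ?_⟩, fun q => ?_⟩
  · rw [Finset.mem_erase] at hb
    have := (h1 j).1 hb.2
    rw [Finset.mem_Ioc] at this ⊢
    omega
  · rw [Finset.card_erase_eq_ite, (h1 j).2]
  -- Every label exceeds `t`, so counting above `q` after the removal of `t + 1` is counting above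
  -- `max q (t + 1)` before it.
  · convert! h2 (max q (t + 1)) using 3 with j
    ext b
    simp only [Finset.mem_filter, Finset.mem_erase, max_lt_iff]
    constructor
    · rintro ⟨⟨h3, h4⟩, h5⟩
      have := (h1 j).1 h4
      rw [Finset.mem_Ioc] at this
      exact ⟨h4, h5, by omega⟩
    · rintro ⟨h3, h4, h5⟩
      exact ⟨⟨by omega, h3⟩, h4⟩

theorem columnFamilies_insert {t s r : ℕ} {l : Fin r → ℕ} (hl : Monotone l) {S : Finset (Fin r)}
    (hS : ∀ j ∈ S, 1 ≤ l j) {B : Fin r → Finset ℕ}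
    (hB : B ∈ columnFamilies (t + 1) s (fun j => if j ∈ S then l j - 1 else l j)) :
    (fun j => if j ∈ S then insert (t + 1) (B j) else B j) ∈ columnFamilies t (s + 1) l := by
  rw [mem_columnFamilies] at hB ⊢
  obtain ⟨h1, h2⟩ := hB
  have hlt : ∀ j, ∀ b ∈ B j, t + 1 < b := fun j b hb => (Finset.mem_Ioc.mp ((h1 j).1 hb)).1
  have hnot : ∀ j, t + 1 ∉ B j := fun j h => lt_irrefl _ (hlt j _ h)
  have hsub : ∀ j, (if j ∈ S then insert (t + 1) (B j) else B j) ⊆ Finset.Ioc t (t + (s + 1)) := by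
    intro j b hb
    have hb' : b = t + 1 ∨ b ∈ B j := by
      split_ifs at hb
      · exact Finset.mem_insert.mp hb
      · exact Or.inr hb
    rw [Finset.mem_Ioc]
    rcases hb' with rfl | hb'
    · omega
    · have := Finset.mem_Ioc.mp ((h1 j).1 hb')
      omega
  have hcard : ∀ j, (if j ∈ S then insert (t + 1) (B j) else B j).card = l j := by
    intro j
    have := (h1 j).2
    split_ifs at this ⊢ with h
    · rw [Finset.card_insert_of_notMem (hnot j), this]
      have := hS j h
      omega
    · exact this
  refine ⟨fun j => ⟨hsub j, hcard j⟩, fun q => ?_⟩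
  -- For `q ≤ t` the whole set is counted, so the condition is that `l` is monotone; for larger `q`
  -- the new label is not counted.
  rcases lt_or_ge q (t + 1) with hq | hq
  · convert! hl using 2 with j
    rw [Finset.filter_true_of_mem, hcard]
    intro b hb
    have := Finset.mem_Ioc.mp (hsub j hb)
    omega
  · convert! h2 q using 3 with j
    split_ifs
    · rw [Finset.filter_insert, if_neg (by omega)]
    · rfl

/-- With no factors left, `e_a` is `1` for `a = 0` and `0` otherwise. If `l ≠ 0`, its last value is
positive by monotonicity, and the last row, whose index exceeds every column index, vanishes. -/
theorem jtDet_zero (x : ℕ → ℂ → ℂ) (t : ℕ) {r : ℕ} {l : Fin r → ℕ} (hl : Monotone l) (u : ℂ) :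
    jtDet x t 0 (fun j => (l j : ℤ) + (j : ℕ)) u = if l = 0 then 1 else 0 := by
  split_ifs with h
  · subst h
    rw [jtDet, ← Matrix.det_one (n := Fin r)]
    congr 1
    ext j k
    simp [esym, Matrix.one_apply, sub_eq_zero, Fin.ext_iff]
  · obtain ⟨j, hj⟩ := Function.ne_iff.mp h
    have hr : 0 < r := j.pos
    refine Matrix.det_eq_zero_of_row_eq_zero ⟨r - 1, by omega⟩ fun k => ?_
    have h1 : l j ≤ l ⟨r - 1, by omega⟩ := hl (by rw [Fin.le_def]; simp; omega)
    have h2 : l j ≠ 0 := hj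
    simp only [Matrix.of_apply, esym]
    rw [if_neg]
    have := k.2
    omega

/-- If the lowered lengths, taken in `ℤ`, are not monotone, then two neighbours have `l_j = l_{j+1}`
with only `j + 1` in `S`, and their rows coincide. If they are monotone but one is negative, then so
is the first, and row `0` vanishes. The condition `1 ≤ l j` guards against truncated subtraction. -/
theorem jtDet_eq_zero_of_not (x : ℕ → ℂ → ℂ) (t s : ℕ) {r : ℕ} {l : Fin r → ℕ} (hl : Monotone l)
    (S : Finset (Fin r)) (u : ℂ)
    (h : ¬ ((∀ j ∈ S, 1 ≤ l j) ∧ Monotone fun j => if j ∈ S then l j - 1 else l j)) :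
    jtDet x t s (fun j => if j ∈ S then (l j : ℤ) + (j : ℕ) - 1 else (l j : ℤ) + (j : ℕ)) u = 0 := by
  rcases r with _ | r
  · exact absurd ⟨fun j => j.elim0, fun j => j.elim0⟩ h
  by_cases hm : Monotone fun j => if j ∈ S then (l j : ℤ) - 1 else l j
  · by_cases h0 : ∀ j ∈ S, 1 ≤ l j
    · exfalso
      refine h ⟨h0, fun j k hjk => ?_⟩
      have h1 := hm hjk
      have h2 := h0 j
      have h3 := h0 k
      simp only at h1 ⊢
      split_ifs at h1 ⊢ with h4 h5 <;> simp_all <;> omega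
    · push Not at h0
      obtain ⟨j, hj, hlj⟩ := h0
      apply jtDet_eq_zero_of_neg (j := 0)
      have h1 := hm (Fin.zero_le j)
      simp only [hj, if_true] at h1
      simp only [Fin.val_zero]
      split_ifs at h1 ⊢ <;> omega
  · rw [Fin.monotone_iff_le_succ] at hm
    push Not at hm
    obtain ⟨j, hj⟩ := hm
    apply jtDet_eq_zero_of_eq (j := j.castSucc) (k := j.succ) _ _ _ _ _
      (Fin.castSucc_lt_succ).ne
    have := hl (Fin.castSucc_lt_succ (i := j)).le
    simp only [Fin.val_castSucc, Fin.val_succ]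
    split_ifs at hj ⊢ <;> push_cast <;> omega

theorem jtDet_eq_sum_columnFamilies (x : ℕ → ℂ → ℂ) (t s : ℕ) {r : ℕ} {l : Fin r → ℕ}
    (hl : Monotone l) (u : ℂ) :
    jtDet x t s (fun j => (l j : ℤ) + (j : ℕ)) u =
      ∑ B ∈ columnFamilies t s l, ∏ j, columnWeight x (B j) (u + 2 * (j : ℕ)) := by
  classical
  induction s generalizing t l with
  | zero =>
    rw [jtDet_zero x t hl]
    split_ifs with h
    · subst h
      have : columnFamilies t 0 (0 : Fin r → ℕ) = {fun _ => ∅} := by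
        ext B
        simp only [mem_columnFamilies, Finset.mem_singleton, funext_iff]
        constructor
        · intro h j
          exact Finset.card_eq_zero.mp (h.1 j).2
        · intro h
          simp [h, monotone_const]
      rw [this, Finset.sum_singleton]
      simp [columnWeight]
    · symm
      apply Finset.sum_eq_zero
      intro B hB
      exfalso
      apply h
      funext j
      have := (mem_columnFamilies.mp hB).1 j
      have hj : B j = ∅ := by simpa using this.1
      rw [← this.2, hj]
      rfl
  | succ s ih =>
    -- The families are grouped by the set `S` of columns containing the smallest label `t + 1`, to
    -- match the terms of the row expansion.
    rw [jtDet_succ, ← Finset.sum_fiberwise (columnFamilies t (s + 1) l)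
      (fun B => Finset.univ.filter fun j => t + 1 ∈ B j)]
    refine Finset.sum_congr rfl fun S _ => ?_
    by_cases hS : (∀ j ∈ S, 1 ≤ l j) ∧ Monotone fun j => if j ∈ S then l j - 1 else l j
    · have h1 : (fun j : Fin r => if j ∈ S then (l j : ℤ) + (j : ℕ) - 1 else (l j : ℤ) + (j : ℕ))
          = fun j => ((if j ∈ S then l j - 1 else l j : ℕ) : ℤ) + (j : ℕ) := by
        funext j
        have := hS.1 j
        split_ifs with h
        · have := this h
          omega
        · rfl
      rw [h1, ih (t + 1) hS.2, Finset.mul_sum]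
      refine Finset.sum_nbij' (fun B j => if j ∈ S then insert (t + 1) (B j) else B j)
        (fun B j => (B j).erase (t + 1)) ?_ ?_ ?_ ?_ ?_
      · intro B hB
        rw [Finset.mem_filter]
        refine ⟨columnFamilies_insert hl hS.1 hB, ?_⟩
        ext j
        have hnot : t + 1 ∉ B j := fun h => by
          simpa using ((mem_columnFamilies.mp hB).1 j).1 h
        by_cases hj : j ∈ S <;> simp [hj, hnot]
      · intro B hB
        rw [Finset.mem_filter] at hB
        have := columnFamilies_step hB.1
        simpa [← hB.2] using this
      · intro B hB
        funext j
        have hnot : t + 1 ∉ B j := fun h => by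
          simpa using ((mem_columnFamilies.mp hB).1 j).1 h
        by_cases hj : j ∈ S <;> simp [hj, hnot]
      · intro B hB
        rw [Finset.mem_filter] at hB
        funext j
        by_cases hj : t + 1 ∈ B j <;> simp [← hB.2, hj]
      · intro B hB
        have h2 : (∏ j ∈ S, x (t + 1) (u + 2 * ((((l j : ℤ) + (j : ℕ) : ℤ) : ℂ) - 1)))
            = ∏ j, if j ∈ S then x (t + 1) (u + 2 * ((((l j : ℤ) + (j : ℕ) : ℤ) : ℂ) - 1))
              else 1 := by
          rw [Finset.prod_ite_mem, Finset.univ_inter]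
        rw [h2, ← Finset.prod_mul_distrib]
        refine Finset.prod_congr rfl fun j _ => ?_
        have h3 := (mem_columnFamilies.mp hB).1 j
        beta_reduce
        split_ifs at h3 ⊢ with hj
        · rw [columnWeight_insert x (fun a ha => (Finset.mem_Ioc.mp (h3.1 ha)).1), h3.2,
            Nat.cast_sub (hS.1 j hj)]
          congr 2
          push_cast
          ring
        · rw [one_mul]
    · rw [jtDet_eq_zero_of_not x (t + 1) s hl S u hS, mul_zero]
      symm
      apply Finset.sum_eq_zero
      intro B hB
      exfalso
      rw [Finset.mem_filter] at hB
      obtain ⟨hB, rfl⟩ := hB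
      apply hS
      have h1 := mem_columnFamilies.mp hB
      constructor
      · intro j hj
        rw [Finset.mem_filter] at hj
        rw [← (h1.1 j).2]
        exact Finset.card_pos.mpr ⟨_, hj.2⟩
      · have h2 := mem_columnFamilies.mp (columnFamilies_step hB)
        have h3 := h2.2 (t + 1)
        convert! h3 using 2 with j
        have h4 := h2.1 j
        rw [Finset.filter_true_of_mem fun b hb => (Finset.mem_Ioc.mp (h4.1 hb)).1, h4.2]
        simp

/-! ### Semistandard tableaux and families of column sets -/

theorem card_filter_image {f : ℕ → ℕ} {n : ℕ} (hf : StrictAntiOn f (Finset.Icc 1 n : Finset ℕ))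
    (q : ℕ) : (((Finset.Icc 1 n).image f).filter (q < ·)).card
      = ((Finset.Icc 1 n).filter fun j => q < f j).card := by
  rw [Finset.filter_image, Finset.card_image_of_injOn]
  exact hf.injOn.mono (Finset.coe_subset.mpr (Finset.filter_subset _ _))

theorem card_filter_image_apply {f : ℕ → ℕ} {n : ℕ}
    (hf : StrictAntiOn f (Finset.Icc 1 n : Finset ℕ)) {j : ℕ} (hj : j ∈ Finset.Icc 1 n) :
    (((Finset.Icc 1 n).image f).filter (f j < ·)).card = j - 1 := by
  rw [card_filter_image hf, show j - 1 = (Finset.Ico 1 j).card by simp]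
  congr 1
  ext k
  rw [Finset.mem_Icc] at hj
  simp only [Finset.mem_filter, Finset.mem_Icc, Finset.mem_Ico]
  constructor
  · rintro ⟨hk, h⟩
    refine ⟨hk.1, ?_⟩
    rwa [hf.lt_iff_gt (by simpa using hj) (by simpa using hk)] at h
  · rintro ⟨h1, h2⟩
    have hk : 1 ≤ k ∧ k ≤ n := ⟨h1, by omega⟩
    exact ⟨hk, hf (by simpa using hk) (by simpa using hj) h2⟩

/-- This translates the counting condition on neighbouring column sets into weak increase along
rows: if `g j < f j`, then at least `j` values of `f` but only `j - 1` values of `g` exceed `g j`.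
-/
theorem le_of_card_filter_image_le {f g : ℕ → ℕ} {m n : ℕ}
    (hf : StrictAntiOn f (Finset.Icc 1 m : Finset ℕ))
    (hg : StrictAntiOn g (Finset.Icc 1 n : Finset ℕ))
    (h : ∀ q, (((Finset.Icc 1 m).image f).filter (q < ·)).card
      ≤ (((Finset.Icc 1 n).image g).filter (q < ·)).card)
    {j : ℕ} (hm : j ∈ Finset.Icc 1 m) (hn : j ∈ Finset.Icc 1 n) : f j ≤ g j := by
  by_contra hlt
  rw [not_le] at hlt
  have h1 := h (g j)
  rw [card_filter_image_apply hg hn, card_filter_image hf] at h1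
  have h2 : Finset.Icc 1 j ⊆ (Finset.Icc 1 m).filter fun i => g j < f i := by
    intro i hi
    have hi' : i ∈ Finset.Icc 1 m := by
      rw [Finset.mem_Icc] at hi hm ⊢
      omega
    rw [Finset.mem_filter]
    exact ⟨hi', hlt.trans_le (hf.antitoneOn (Finset.mem_coe.mpr hi') (Finset.mem_coe.mpr hm)
      (Finset.mem_Icc.mp hi).2)⟩
  have h3 := Finset.card_le_card h2
  rw [Nat.card_Icc] at h3
  rw [Finset.mem_Icc] at hn
  omega

theorem exists_strictAntiOn_image_eq (A : Finset ℕ) :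
    ∃ f : ℕ → ℕ, StrictAntiOn f (Finset.Icc 1 A.card : Finset ℕ) ∧
      (Finset.Icc 1 A.card).image f = A := by
  -- The index `A.card - j` reverses the increasing enumeration, so that `j = 1`, the bottom box,
  -- receives the largest label.
  let f : ℕ → ℕ := fun j =>
    if h : j ∈ Finset.Icc 1 A.card then
      A.orderEmbOfFin rfl ⟨A.card - j, by rw [Finset.mem_Icc] at h; omega⟩ else 0
  have hf : StrictAntiOn f (Finset.Icc 1 A.card : Finset ℕ) := by
    intro j hj k hk hjk
    rw [Finset.mem_coe] at hj hk
    simp only [f, dif_pos hj, dif_pos hk]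
    apply (A.orderEmbOfFin rfl).strictMono
    rw [Fin.lt_def]
    rw [Finset.mem_Icc] at hj hk
    simp only
    omega
  refine ⟨f, hf, Finset.eq_of_subset_of_card_le ?_ ?_⟩
  · intro a ha
    rw [Finset.mem_image] at ha
    obtain ⟨j, hj, rfl⟩ := ha
    simp only [f, dif_pos hj]
    exact A.orderEmbOfFin_mem rfl _
  · rw [Finset.card_image_of_injOn hf.injOn, Nat.card_Icc]
    omega

theorem columnWeight_image (x : ℕ → ℂ → ℂ) {f : ℕ → ℕ} {n : ℕ}
    (hf : StrictAntiOn f (Finset.Icc 1 n : Finset ℕ)) (v : ℂ) :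
    columnWeight x ((Finset.Icc 1 n).image f) v
      = ∏ j ∈ Finset.Icc 1 n, x (f j) (v + 2 * ((j : ℂ) - 1)) := by
  rw [columnWeight, Finset.prod_image hf.injOn]
  refine Finset.prod_congr rfl fun j hj => ?_
  rw [card_filter_image_apply hf hj, Nat.cast_sub (Finset.mem_Icc.mp hj).1, Nat.cast_one]

theorem mem_skewCells {R : ℕ} {μ : YoungDiagram} {c : ℕ × ℕ} :
    c ∈ skewCells R μ ↔ c.2 ∈ Finset.Icc 1 (μ.rowLen 0) ∧
      c.1 ∈ Finset.Icc 1 (R - μ.colLen (c.2 - 1)) := by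
  simp only [skewCells, Finset.mem_filter, Finset.mem_product, Finset.mem_Icc,
    YoungDiagram.mem_iff_lt_colLen]
  omega

/-- The entry of a filling at `(j, k)`, and `0` outside of the diagram. -/
def entry {R : ℕ} {μ : YoungDiagram} (b : Filling R μ) (k j : ℕ) : ℕ :=
  if h : (j, k) ∈ skewCells R μ then b ⟨(j, k), h⟩ else 0

theorem entry_coe {R : ℕ} {μ : YoungDiagram} (b : Filling R μ) (c : skewCells R μ) :
    entry b c.1.2 c.1.1 = b c := by
  rw [entry, dif_pos c.2]

theorem mk_mem_skewCells {R : ℕ} {μ : YoungDiagram} (k : Fin (μ.rowLen 0)) {j : ℕ} :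
    (j, (k : ℕ) + 1) ∈ skewCells R μ ↔ j ∈ Finset.Icc 1 (R - μ.colLen k) := by
  rw [mem_skewCells, Nat.add_sub_cancel, Finset.mem_Icc]
  have := k.2
  constructor
  · exact fun h => h.2
  · exact fun h => ⟨by omega, h⟩

theorem entry_strictAntiOn {R : ℕ} {μ : YoungDiagram} {b : Filling R μ} (hb : IsSemistandard b)
    (k : Fin (μ.rowLen 0)) :
    StrictAntiOn (entry b (k + 1)) (Finset.Icc 1 (R - μ.colLen k) : Finset ℕ) := by
  intro i hi j hj hij
  rw [Finset.mem_coe, ← mk_mem_skewCells] at hi hj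
  rw [entry, entry, dif_pos hi, dif_pos hj]
  exact hb.2 ⟨_, hi⟩ ⟨_, hj⟩ rfl hij

/-- The set of the entries in each column. -/
def columnSets {R : ℕ} {μ : YoungDiagram} (b : Filling R μ) (k : Fin (μ.rowLen 0)) : Finset ℕ :=
  (Finset.Icc 1 (R - μ.colLen k)).image (entry b (k + 1))

theorem columnSets_mem {R : ℕ} {μ : YoungDiagram} {b : Filling R μ} (hb : IsSemistandard b) :
    columnSets b ∈ columnFamilies 0 R fun k : Fin (μ.rowLen 0) => R - μ.colLen k := by
  rw [mem_columnFamilies]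
  refine ⟨fun k => ⟨?_, ?_⟩, fun q k m hkm => ?_⟩
  · intro a ha
    obtain ⟨j, hj, rfl⟩ := Finset.mem_image.mp ha
    rw [entry, dif_pos (mk_mem_skewCells k |>.mpr hj)]
    have := Finset.mem_Icc.mp (b ⟨(j, (k : ℕ) + 1), mk_mem_skewCells k |>.mpr hj⟩).2
    rw [Finset.mem_Ioc]
    omega
  · rw [columnSets, Finset.card_image_of_injOn (entry_strictAntiOn hb k).injOn, Nat.card_Icc]
    omega
  · simp only [columnSets]
    rw [card_filter_image (entry_strictAntiOn hb k), card_filter_image (entry_strictAntiOn hb m)]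
    apply Finset.card_le_card
    intro j hj
    rw [Finset.mem_filter] at hj ⊢
    have h1 : j ∈ Finset.Icc 1 (R - μ.colLen m) := by
      have := μ.colLen_anti k m hkm
      rw [Finset.mem_Icc] at hj ⊢
      omega
    refine ⟨h1, hj.2.trans_le ?_⟩
    rw [← mk_mem_skewCells] at h1
    have h2 := (mk_mem_skewCells k).mpr hj.1
    rw [entry, entry, dif_pos h1, dif_pos h2]
    exact hb.1 ⟨_, h2⟩ ⟨_, h1⟩ rfl (by simpa using hkm)

/-- The entry in row `j` of a column is recovered from the set of entries as the element with
exactly `j - 1` larger ones. -/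
theorem columnSets_injective {R : ℕ} {μ : YoungDiagram} {b b' : Filling R μ}
    (hb : IsSemistandard b) (hb' : IsSemistandard b') (h : columnSets b = columnSets b') :
    b = b' := by
  have key : ∀ k : Fin (μ.rowLen 0), ∀ j ∈ Finset.Icc 1 (R - μ.colLen k),
      entry b (k + 1) j = entry b' (k + 1) j := by
    intro k j hj
    have hk := congrFun h k
    simp only [columnSets] at hk
    have h1 : entry b (k + 1) j ∈ (Finset.Icc 1 (R - μ.colLen k)).image (entry b' (k + 1)) := by
      rw [← hk]
      exact Finset.mem_image_of_mem _ hj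
    obtain ⟨i, hi, hij⟩ := Finset.mem_image.mp h1
    have h2 := card_filter_image_apply (entry_strictAntiOn hb k) hj
    have h3 := card_filter_image_apply (entry_strictAntiOn hb' k) hi
    rw [hk, ← hij, h3] at h2
    rw [Finset.mem_Icc] at hi hj
    obtain rfl : i = j := by omega
    exact hij.symm
  funext c
  apply Subtype.ext
  rw [← entry_coe, ← entry_coe]
  have hc := mem_skewCells.mp c.2
  have hk := Finset.mem_Icc.mp hc.1
  have := key ⟨c.1.2 - 1, by omega⟩ c.1.1 hc.2
  rwa [show c.1.2 - 1 + 1 = c.1.2 by omega] at this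

theorem columnSets_surjective {R : ℕ} {μ : YoungDiagram} {B : Fin (μ.rowLen 0) → Finset ℕ}
    (hB : B ∈ columnFamilies 0 R fun k : Fin (μ.rowLen 0) => R - μ.colLen k) :
    ∃ b : Filling R μ, IsSemistandard b ∧ columnSets b = B := by
  rw [mem_columnFamilies] at hB
  choose F hF1 hF2 using fun k => exists_strictAntiOn_image_eq (B k)
  simp only [(hB.1 _).2] at hF1 hF2
  have hcol : ∀ c : skewCells R μ, c.1.2 - 1 < μ.rowLen 0 := fun c => by
    have := Finset.mem_Icc.mp (mem_skewCells.mp c.2).1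
    omega
  have hrow : ∀ c : skewCells R μ, c.1.1 ∈ Finset.Icc 1 (R - μ.colLen (c.1.2 - 1)) :=
    fun c => (mem_skewCells.mp c.2).2
  obtain ⟨b, hb⟩ : ∃ b : Filling R μ, ∀ c, (b c : ℕ) = F ⟨c.1.2 - 1, hcol c⟩ c.1.1 := by
    refine ⟨fun c => ⟨F ⟨c.1.2 - 1, hcol c⟩ c.1.1, ?_⟩, fun c => rfl⟩
    have h1 : F ⟨c.1.2 - 1, hcol c⟩ c.1.1 ∈ B ⟨c.1.2 - 1, hcol c⟩ := by
      rw [← hF2 ⟨c.1.2 - 1, hcol c⟩]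
      exact Finset.mem_image_of_mem _ (hrow c)
    have := Finset.mem_Ioc.mp ((hB.1 _).1 h1)
    rw [Finset.mem_Icc]
    omega
  refine ⟨b, ⟨?_, ?_⟩, ?_⟩
  · rintro ⟨⟨j, k⟩, hc⟩ ⟨⟨j', m⟩, hd⟩ h1 h2
    simp only at h1 h2
    subst h1
    rw [hb, hb]
    have hrc := hrow ⟨_, hc⟩
    have hrd := hrow ⟨_, hd⟩
    refine le_of_card_filter_image_le (hF1 ⟨k - 1, hcol ⟨_, hc⟩⟩) (hF1 ⟨m - 1, hcol ⟨_, hd⟩⟩)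
      (fun q => ?_) hrc hrd
    rw [hF2, hF2]
    exact hB.2 q (Fin.mk_le_mk.mpr (by omega))
  · rintro ⟨⟨c1, c2⟩, hc⟩ ⟨⟨d1, d2⟩, hd⟩ h1 h2
    simp only at h1 h2
    subst h1
    rw [hb, hb]
    have hrc := hrow ⟨_, hc⟩
    have hrd := hrow ⟨_, hd⟩
    exact hF1 ⟨c2 - 1, hcol ⟨_, hc⟩⟩ (Finset.mem_coe.mpr hrc) (Finset.mem_coe.mpr hrd) h2
  · funext k
    rw [← hF2 k, columnSets]
    apply Finset.image_congr
    intro j hj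
    rw [Finset.mem_coe] at hj
    rw [entry, dif_pos (mk_mem_skewCells k |>.mpr hj)]
    simp [hb]

theorem sum_semistandardTableaux (x : ℕ → ℂ → ℂ) (R : ℕ) (μ : YoungDiagram) (u : ℂ) :
    ∑ b ∈ semistandardTableaux R μ, ∏ c : skewCells R μ,
        x (b c) (u + 2 * (c.1.1 : ℂ) + 2 * (c.1.2 : ℂ) - 4) =
      ∑ B ∈ columnFamilies 0 R fun k : Fin (μ.rowLen 0) => R - μ.colLen k,
        ∏ k, columnWeight x (B k) (u + 2 * (k : ℕ)) := by
  refine Finset.sum_nbij columnSets ?_ ?_ ?_ ?_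
  · intro b hb
    exact columnSets_mem (by simpa [semistandardTableaux] using hb)
  · intro b hb b' hb' h
    exact columnSets_injective (by simpa [semistandardTableaux] using hb)
      (by simpa [semistandardTableaux] using hb') h
  · intro B hB
    obtain ⟨b, hb, rfl⟩ := columnSets_surjective hB
    exact ⟨b, by simpa [semistandardTableaux] using hb, rfl⟩
  · intro b hb
    have hb : IsSemistandard b := by simpa [semistandardTableaux] using hb
    have h1 : ∏ c : skewCells R μ, x (b c) (u + 2 * (c.1.1 : ℂ) + 2 * (c.1.2 : ℂ) - 4)
        = ∏ c ∈ skewCells R μ, x (entry b c.2 c.1) (u + 2 * (c.1 : ℂ) + 2 * (c.2 : ℂ) - 4) := by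
      refine Eq.trans ?_ (Finset.prod_coe_sort (skewCells R μ) fun c =>
        x (entry b c.2 c.1) (u + 2 * (c.1 : ℂ) + 2 * (c.2 : ℂ) - 4))
      exact Finset.prod_congr rfl fun c _ => by rw [entry_coe]
    -- The product over boxes is taken column by column; then the column index is shifted to start
    -- from `0`.
    rw [h1, Finset.prod_finset_product_right' (skewCells R μ) (Finset.Icc 1 (μ.rowLen 0))
      (fun k => Finset.Icc 1 (R - μ.colLen (k - 1))) (fun c => mem_skewCells)
      (f := fun j k => x (entry b k j) (u + 2 * (j : ℂ) + 2 * (k : ℂ) - 4))]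
    have h2 : Finset.Icc 1 (μ.rowLen 0) = (Finset.range (μ.rowLen 0)).image (· + 1) := by
      ext k
      simp only [Finset.mem_Icc, Finset.mem_image, Finset.mem_range]
      constructor
      · exact fun h => ⟨k - 1, by omega, by omega⟩
      · rintro ⟨k, h, rfl⟩
        omega
    rw [h2, Finset.prod_image (by intro _ _ _ _ h; simpa using h), Finset.prod_range]
    refine Finset.prod_congr rfl fun k _ => ?_
    rw [columnSets, columnWeight_image x (entry_strictAntiOn hb k), Nat.add_sub_cancel]
    refine Finset.prod_congr rfl fun j _ => ?_
    congr 1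
    push_cast
    ring

/-! ### Complementary minors -/

theorem submatrix_mul_add_submatrix_mul {m n r q s : Type*} [Fintype m] [Fintype n] [Fintype r]
    (A : Matrix s m ℂ) (V : Matrix m q ℂ) (σ : n ⊕ r ≃ m) :
    A.submatrix id (σ ∘ Sum.inl) * V.submatrix (σ ∘ Sum.inl) id
      + A.submatrix id (σ ∘ Sum.inr) * V.submatrix (σ ∘ Sum.inr) id = A * V := by
  ext i j
  simp only [Matrix.add_apply, Matrix.mul_apply, Matrix.submatrix_apply, id, Function.comp_apply]
  rw [← Fintype.sum_sum_type (fun k => A i (σ k) * V (σ k) j)]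
  exact Equiv.sum_comp σ fun k => A i k * V k j

/-- Jacobi's complementary minors: if the columns of `W` are annihilated by `A`, then the maximal
minors of `W` are proportional, up to signs, to the complementary minors of `A`. -/
theorem det_mul_det_of_mul_eq_zero {m n r : Type*} [Fintype m] [DecidableEq m] [Fintype n]
    [DecidableEq n] [Fintype r] [DecidableEq r] (W : Matrix m n ℂ) (A : Matrix r m ℂ)
    (h : A * W = 0) (σ τ : n ⊕ r ≃ m) :
    (W.submatrix (σ ∘ Sum.inl) id).det * (A.submatrix id (τ ∘ Sum.inr)).det
      = (Equiv.Perm.sign (σ.trans τ.symm) : ℤ) * (A.submatrix id (σ ∘ Sum.inr)).det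
        * (W.submatrix (τ ∘ Sum.inl) id).det := by
  -- `W` is completed to a square matrix `G` by unit columns at the positions `τ ∘ Sum.inr`. Then `A
  -- * W = 0` makes the product in `h1` block triangular, and comparing determinants needs no minor
  -- to be invertible.
  let F : Matrix m r ℂ := (1 : Matrix m m ℂ).submatrix id (τ ∘ Sum.inr)
  let G : Matrix m (n ⊕ r) ℂ := Matrix.of fun i => Sum.elim (W i) (F i)
  have hG : ∀ e : n ⊕ r ≃ m, G.submatrix e id = Matrix.fromBlocks (W.submatrix (e ∘ Sum.inl) id)
      (F.submatrix (e ∘ Sum.inl) id) (W.submatrix (e ∘ Sum.inr) id)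
      (F.submatrix (e ∘ Sum.inr) id) := by
    intro e
    ext (i | i) (j | j) <;> rfl
  have h1 : Matrix.fromBlocks 1 0 (A.submatrix id (σ ∘ Sum.inl)) (A.submatrix id (σ ∘ Sum.inr))
      * G.submatrix σ id = Matrix.fromBlocks (W.submatrix (σ ∘ Sum.inl) id)
        (F.submatrix (σ ∘ Sum.inl) id) 0 (A.submatrix id (τ ∘ Sum.inr)) := by
    rw [hG, Matrix.fromBlocks_multiply, submatrix_mul_add_submatrix_mul A W,
      submatrix_mul_add_submatrix_mul A F, h]
    have : A * F = A.submatrix id (τ ∘ Sum.inr) := by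
      ext i j
      simp [F, Matrix.mul_apply, Matrix.one_apply]
    rw [this]
    simp
  have h2 : (G.submatrix τ id).det = (W.submatrix (τ ∘ Sum.inl) id).det := by
    have e1 : F.submatrix (τ ∘ Sum.inl) id = 0 := by
      ext i j
      simp [F]
    have e2 : F.submatrix (τ ∘ Sum.inr) id = 1 := by
      ext i j
      simp [F, Matrix.one_apply]
    rw [hG, e1, e2, Matrix.det_fromBlocks_zero₁₂, Matrix.det_one, mul_one]
  have h3 : (G.submatrix σ id).det
      = (Equiv.Perm.sign (σ.trans τ.symm) : ℤ) * (G.submatrix τ id).det := by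
    rw [← Matrix.det_permute]
    congr 1
    ext i j
    simp
  have h4 := congrArg Matrix.det h1
  rw [Matrix.det_mul, Matrix.det_fromBlocks_zero₁₂, Matrix.det_fromBlocks_zero₂₁, Matrix.det_one,
    one_mul, h3, h2] at h4
  rw [← h4]
  ring

/-- The sign of the shuffle `(i_1, …, i_n, c_1, …, c_r)`, where `c_k = l_k + k`. -/
theorem sign_shuffle {n r : ℕ} {i : Fin n → ℕ} {l : Fin r → ℕ} (hi : StrictMono i)
    (hl : Monotone l) (h1 : ∀ (a : Fin n) k, (a : ℕ) < l k → i a < l k + k)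
    (h2 : ∀ (a : Fin n) k, l k ≤ (a : ℕ) → l k + k < i a)
    (σ : Fin n ⊕ Fin r ≃ Fin (n + r)) (hσl : ∀ a, (σ (Sum.inl a) : ℕ) = i a)
    (hσr : ∀ k, (σ (Sum.inr k) : ℕ) = l k + k) :
    Equiv.Perm.sign (σ.trans finSumFinEquiv.symm) = ∏ k, (-1) ^ (n - l k) := by
  rw [← Equiv.Perm.sign_symm_trans_trans (σ.trans finSumFinEquiv.symm) finSumFinEquiv]
  set π : Equiv.Perm (Fin (n + r)) :=
    (finSumFinEquiv.symm.trans (σ.trans finSumFinEquiv.symm)).trans finSumFinEquiv with hπ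
  have hπl : ∀ a, (π (Fin.castAdd r a) : ℕ) = i a := fun a => by simp [hπ, hσl]
  have hπr : ∀ k, (π (Fin.natAdd n k) : ℕ) = l k + k := fun k => by simp [hπ, hσr]
  have hc : ∀ j k : Fin r, j < k → l j + j < l k + k := fun j k hjk => by
    have := hl hjk.le
    have := Fin.lt_def.mp hjk
    omega
  have hIio : ∀ j : Fin (n + r), ∏ m ∈ Finset.Iio j, (if π m < π j then (1 : ℤˣ) else -1)
      = ∏ m, if m < j ∧ ¬ π m < π j then -1 else 1 := by
    intro j
    rw [← Finset.univ_inter (Finset.Iio j), ← Finset.prod_ite_mem]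
    refine Finset.prod_congr rfl fun m _ => ?_
    simp only [Finset.mem_Iio]
    split_ifs <;> simp_all
  rw [Equiv.Perm.sign_eq_prod_prod_Iio, Finset.prod_congr rfl fun j _ => hIio j]
  simp only [Fin.prod_univ_add, Fin.lt_def, hπl, hπr, Fin.val_castAdd, Fin.val_natAdd]
  have e1 : ∀ a b : Fin n, ¬ ((b : ℕ) < a ∧ ¬ i b < i a) := fun a b h => h.2 (hi h.1)
  have e2 : ∀ (a : Fin n) (k : Fin r), ¬ (n + (k : ℕ) < a ∧ ¬ l k + k < i a) := fun a k h => by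
    omega
  have e3 : ∀ j k : Fin r, ¬ (n + (j : ℕ) < n + k ∧ ¬ l j + j < l k + k) := fun j k h =>
    h.2 (hc j k (by rw [Fin.lt_def]; omega))
  simp only [e1, e2, e3, if_false, Finset.prod_const_one, one_mul, mul_one]
  refine Finset.prod_congr rfl fun k _ => ?_
  -- The remaining inversions pair some `i a` with `l k + k`; for fixed `k` they are the indices `a`
  -- with `l k ≤ a < n`.
  have e4 : ∀ a : Fin n, (((a : ℕ) < n + k ∧ ¬ i a < l k + k) ↔ l k ≤ (a : ℕ)) := by
    intro a
    have := h1 a k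
    have := h2 a k
    omega
  simp only [e4]
  rw [Fin.prod_univ_eq_prod_range (fun a => if l k ≤ a then (-1 : ℤˣ) else 1) n, Finset.prod_ite,
    Finset.prod_const_one, mul_one, Finset.prod_const]
  congr 1
  rw [show n - l k = (Finset.Ico (l k) n).card by simp]
  congr 1
  ext a
  simp only [Finset.mem_filter, Finset.mem_range, Finset.mem_Ico]
  omega

/-- The shuffle as a bijection. -/
theorem exists_shuffle {n r : ℕ} {i : Fin n → ℕ} {l : Fin r → ℕ} (hi : StrictMono i)
    (hl : Monotone l) (hln : ∀ k, l k ≤ n) (hin : ∀ a, i a < n + r)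
    (h1 : ∀ (a : Fin n) k, (a : ℕ) < l k → i a < l k + k)
    (h2 : ∀ (a : Fin n) k, l k ≤ (a : ℕ) → l k + k < i a) :
    ∃ σ : Fin n ⊕ Fin r ≃ Fin (n + r), (∀ a, (σ (Sum.inl a) : ℕ) = i a) ∧
      ∀ k, (σ (Sum.inr k) : ℕ) = l k + k := by
  let f : Fin n ⊕ Fin r → Fin (n + r) := Sum.elim (fun a => ⟨i a, hin a⟩)
    fun k => ⟨l k + k, by have := hln k; omega⟩
  have hne : ∀ a k, i a ≠ l k + k := fun a k => by
    have := h1 a k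
    have := h2 a k
    omega
  have hf : Function.Injective f := by
    rintro (a | a) (b | b) h
    · simpa [f, hi.injective.eq_iff] using h
    · exact absurd (congrArg Fin.val h) (hne a b)
    · exact absurd (congrArg Fin.val h).symm (hne b a)
    · have h' : l a + a = l b + b := congrArg Fin.val h
      rcases lt_trichotomy a b with hab | hab | hab
      · have := hl hab.le
        rw [Fin.lt_def] at hab
        omega
      · rw [hab]
      · have := hl hab.le
        rw [Fin.lt_def] at hab
        omega
  have hb : Function.Bijective f := (Fintype.bijective_iff_injective_and_card f).mpr ⟨hf, by simp⟩
  exact ⟨Equiv.ofBijective f hb, fun a => rfl, fun k => rfl⟩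

/-! ### Casorati determinants -/

/-- The Casorati determinants of solutions of a difference equation of order `n`. -/
theorem casorati_det_eq_jtDet_mul (x : ℕ → ℂ → ℂ) {n r : ℕ} (w : Fin n → ℂ → ℂ) (u : ℂ)
    (hw : ∀ b, ∀ k < r, ∑ a ∈ Finset.range (n + 1),
      (-1) ^ a * esym x 0 n a (u + 2 * (k : ℂ)) * w b (u + 2 * (k : ℂ) + 2 * (a : ℂ)) = 0)
    (hlast : ∀ k < r, esym x 0 n n (u + 2 * (k : ℂ)) = 1)
    {i : Fin n → ℕ} {l : Fin r → ℕ} (hi : StrictMono i)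
    (hl : Monotone l) (hln : ∀ k, l k ≤ n) (hin : ∀ a, i a < n + r)
    (h1 : ∀ (a : Fin n) k, (a : ℕ) < l k → i a < l k + k)
    (h2 : ∀ (a : Fin n) k, l k ≤ (a : ℕ) → l k + k < i a) :
    (Matrix.of fun b k : Fin n => w b (u + 2 * (i k : ℂ))).det
      = jtDet x 0 n (fun k => (l k : ℤ) + (k : ℕ)) u *
        (Matrix.of fun b k : Fin n => w b (u + 2 * ((k : ℕ) : ℂ))).det := by
  obtain ⟨σ, hσl, hσr⟩ := exists_shuffle hi hl hln hin h1 h2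
  let W : Matrix (Fin (n + r)) (Fin n) ℂ := Matrix.of fun m b => w b (u + 2 * ((m : ℕ) : ℂ))
  -- Row `k` is the recurrence at `u + 2k`, shifted by `k` places. The sign of its entry is split as
  -- `(-1)^k (-1)^m`, so that it factors out of rows and columns.
  let A : Matrix (Fin r) (Fin (n + r)) ℂ := Matrix.of fun k m =>
    (-1) ^ (k : ℕ) * ((-1) ^ (m : ℕ) *
      esym x 0 n (((m : ℕ) : ℤ) - (k : ℕ)) (u + 2 * ((k : ℕ) : ℂ)))
  have hAW : A * W = 0 := by
    ext k b
    rw [Matrix.mul_apply, Matrix.zero_apply, ← hw b k k.2]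
    simp only [A, W, Matrix.of_apply]
    rw [Fin.sum_univ_eq_sum_range (fun m : ℕ => (-1) ^ (k : ℕ) * ((-1) ^ m *
      esym x 0 n ((m : ℤ) - (k : ℕ)) (u + 2 * ((k : ℕ) : ℂ))) * w b (u + 2 * (m : ℂ)))]
    symm
    refine Finset.sum_of_injOn (fun a => (k : ℕ) + a) (by intro _ _ _ _ h; simpa using h) ?_ ?_ ?_
    · intro a ha
      have := k.2
      simp only [Finset.coe_range, Set.mem_Iio] at ha ⊢
      omega
    · intro m _ hm
      have hm' : (m : ℤ) < (k : ℕ) ∨ ((k : ℕ) + n : ℤ) < m := by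
        by_contra hcon
        apply hm
        refine ⟨m - k, ?_, ?_⟩
        · rw [Finset.coe_range, Set.mem_Iio]
          omega
        · simp only
          omega
      rcases hm' with hm' | hm'
      · rw [esym_of_neg _ _ _ (by omega)]
        simp
      · rw [esym_of_lt _ _ _ (by omega)]
        simp
    · intro a _
      have e1 : (-1 : ℂ) ^ (k : ℕ) * (-1) ^ (k : ℕ) = 1 := by
        rw [← mul_pow]
        simp
      rw [show (((k : ℕ) + a : ℕ) : ℤ) - (k : ℕ) = a by push_cast; ring, pow_add,
        show u + 2 * (((k : ℕ) + a : ℕ) : ℂ) = u + 2 * ((k : ℕ) : ℂ) + 2 * (a : ℂ) by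
          push_cast; ring]
      linear_combination (-((-1) ^ a * esym x 0 n a (u + 2 * ((k : ℕ) : ℂ)) *
        w b (u + 2 * ((k : ℕ) : ℂ) + 2 * (a : ℂ)))) * e1
  have key := det_mul_det_of_mul_eq_zero W A hAW σ finSumFinEquiv
  rw [sign_shuffle hi hl h1 h2 σ hσl hσr] at key
  -- The last `r` columns form a lower triangular block, with the top coefficient `e_n = 1` on the
  -- diagonal up to sign.
  have d1 : (A.submatrix id (finSumFinEquiv ∘ Sum.inr)).det = ∏ _k : Fin r, (-1 : ℂ) ^ n := by
    rw [Matrix.det_of_isLowerTriangular]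
    · refine Finset.prod_congr rfl fun k _ => ?_
      simp only [A, Matrix.submatrix_apply, Matrix.of_apply, id, Function.comp_apply,
        finSumFinEquiv_apply_right, Fin.val_natAdd]
      rw [show ((n + (k : ℕ) : ℕ) : ℤ) - (k : ℕ) = n by push_cast; ring, hlast k k.2, mul_one,
        ← pow_add, show (k : ℕ) + (n + k) = n + 2 * k by ring, pow_add, pow_mul]
      simp
    · intro k j hkj
      have hkj' : (k : ℕ) < j := hkj
      simp only [A, Matrix.submatrix_apply, Matrix.of_apply, id, Function.comp_apply,
        finSumFinEquiv_apply_right, Fin.val_natAdd]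
      rw [esym_of_lt _ _ _ (by push_cast; omega)]
      simp
  have d2 : (A.submatrix id (σ ∘ Sum.inr)).det = (∏ k : Fin r, (-1 : ℂ) ^ (k : ℕ)) *
      ((∏ k : Fin r, (-1 : ℂ) ^ (l k + k)) * jtDet x 0 n (fun k => (l k : ℤ) + (k : ℕ)) u) := by
    rw [jtDet, ← Matrix.det_transpose (Matrix.of _), ← Matrix.det_mul_row, ← Matrix.det_mul_column]
    congr 1
    ext k j
    simp [A, hσr]
  have d3 : ∀ (i' : Fin n → ℕ) (e : Fin n → Fin (n + r)), (∀ a, (e a : ℕ) = i' a) →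
      (W.submatrix e id).det = (Matrix.of fun b k : Fin n => w b (u + 2 * (i' k : ℂ))).det := by
    intro i' e he
    rw [← Matrix.det_transpose]
    congr 1
    ext b k
    simp [W, he]
  rw [d1, d2, d3 i (σ ∘ Sum.inl) hσl,
    d3 (fun k => k) (finSumFinEquiv ∘ Sum.inl) (fun a => by simp)] at key
  -- The shuffle sign and the row and column signs of the minor together give `(-1)^n` for each `k`,
  -- which is the sign of the triangular minor.
  have hs : ((∏ k : Fin r, (-1 : ℤˣ) ^ (n - l k) : ℤˣ) : ℤ) * ((∏ k : Fin r, (-1 : ℂ) ^ (k : ℕ)) *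
      ∏ k : Fin r, (-1 : ℂ) ^ (l k + k)) = ∏ _k : Fin r, (-1 : ℂ) ^ n := by
    push_cast
    rw [← Finset.prod_mul_distrib, ← Finset.prod_mul_distrib]
    refine Finset.prod_congr rfl fun k _ => ?_
    rw [← pow_add, ← pow_add, show n - l k + (k + (l k + k)) = n + 2 * k by
      have := hln k; omega, pow_add, pow_mul]
    simp
  have hne : (∏ _k : Fin r, (-1 : ℂ) ^ n) ≠ 0 := Finset.prod_ne_zero_iff.mpr fun _ _ => by simp
  apply mul_right_cancel₀ hne
  rw [key, ← hs]
  ring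

section Solutions

variable {N : ℕ} {ħ : ℂ} {Q : ℕ → ℂ → ℂ} {Ω : Set ℂ}

theorem add_two_mul_intCast_mem (hΩ : ∀ u ∈ Ω, ∀ r s : ℤ, u + r + s * halfPeriod ħ ∈ Ω)
    {u : ℂ} (hu : u ∈ Ω) (m : ℤ) : u + 2 * (m : ℂ) ∈ Ω := by
  simpa using add_intCast_mem hΩ hu (2 * m)

/-- A solution which vanishes at `u, u + 2, …, u + 2N` vanishes on `u + 2ℤ`. -/
theorem eq_zero_of_recurrence (hN : 2 ≤ N)
    (hΩ : ∀ u ∈ Ω, ∀ r s : ℤ, u + r + s * halfPeriod ħ ∈ Ω)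
    (hQ : ∀ a : ℕ, 1 ≤ a → a ≤ (N + 1) / 2 → ∀ u ∈ Ω, Q a u ≠ 0)
    (hper : ∀ a : ℕ, 1 ≤ a → a ≤ (N + 1) / 2 →
      ∃ h : ℂ, ∀ u ∈ Ω, Q a (u + (Real.pi : ℂ) * Complex.I / ħ) = h * Q a u)
    {f : ℂ → ℂ} (hf : ∀ z ∈ Ω, ∑ k ∈ Finset.range (N + 2),
      (-1) ^ k * esym (x N ħ Q) 0 (N + 1) k z * f (z + 2 * (k : ℂ)) = 0)
    {u : ℂ} (hu : u ∈ Ω) (h0 : ∀ k < N + 1, f (u + 2 * (k : ℂ)) = 0) (m : ℤ) :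
    f (u + 2 * (m : ℂ)) = 0 := by
  -- The induction carries a window of `N + 1` consecutive zeros. The top coefficient `e_{N+1} = 1`
  -- moves it forwards and the constant coefficient `e_0 = 1` backwards.
  suffices h : ∀ k < N + 1, f (u + 2 * (m : ℂ) + 2 * ((k : ℕ) : ℂ)) = 0 by
    simpa using h 0 (by omega)
  induction m using Int.induction_on with
  | zero => simpa using h0
  | succ m ih =>
    intro k hk
    rcases Nat.lt_succ_iff_lt_or_eq.mp hk with hk | rfl
    · have := ih (k + 1) (by omega)
      convert! this using 2
      push_cast
      ring
    · have hz := add_two_mul_intCast_mem hΩ hu m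
      have h1 := hf _ hz
      rw [Finset.sum_range_succ, Finset.sum_eq_zero, zero_add, Nat.cast_add, Nat.cast_one,
        esym_last hN hΩ hQ hper hz, mul_one] at h1
      · have h2 := (mul_eq_zero.mp h1).resolve_left (by simp)
        convert! h2 using 2
        push_cast
        ring
      · intro j hj
        rw [ih j (Finset.mem_range.mp hj), mul_zero]
  | pred m ih =>
    intro k hk
    rcases Nat.eq_zero_or_pos k with rfl | hk0
    · have hz := add_two_mul_intCast_mem hΩ hu (-m - 1)
      have h1 := hf _ hz
      rw [Finset.sum_range_succ', Finset.sum_eq_zero, zero_add, Nat.cast_zero,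
        esym_zero, pow_zero, one_mul, one_mul] at h1
      · simpa using h1
      · intro j hj
        have h2 := ih j (Finset.mem_range.mp hj)
        have h3 : u + 2 * ((-m - 1 : ℤ) : ℂ) + 2 * ((j + 1 : ℕ) : ℂ)
            = u + 2 * ((-m : ℤ) : ℂ) + 2 * (j : ℂ) := by
          push_cast
          ring
        rw [h3, h2, mul_zero]
    · have := ih (k - 1) (by omega)
      convert! this using 2
      rw [Nat.cast_sub hk0]
      push_cast
      ring

/-- A vanishing determinant at `u` gives a combination of the `w_b` with constant coefficients, not
all zero, which vanishes at `N + 1` consecutive points and hence on all of `u + 2ℤ`. This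
contradicts independence over the functions of period `2`. -/
theorem casorati_ne_zero (hN : 2 ≤ N)
    (hΩ : ∀ u ∈ Ω, ∀ r s : ℤ, u + r + s * halfPeriod ħ ∈ Ω)
    (hQ : ∀ a : ℕ, 1 ≤ a → a ≤ (N + 1) / 2 → ∀ u ∈ Ω, Q a u ≠ 0)
    (hper : ∀ a : ℕ, 1 ≤ a → a ≤ (N + 1) / 2 →
      ∃ h : ℂ, ∀ u ∈ Ω, Q a (u + (Real.pi : ℂ) * Complex.I / ħ) = h * Q a u)
    {w : Fin (N + 1) → ℂ → ℂ} (hw : IsSolutionBasis N ħ Q Ω w) {u : ℂ} (hu : u ∈ Ω) :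
    casorati w (fun k => (k : ℕ)) u ≠ 0 := by
  classical
  intro hdet
  obtain ⟨v, hv, hv0⟩ := Matrix.exists_vecMul_eq_zero_iff.mpr hdet
  have h1 : ∀ m : ℤ, ∑ b, v b * w b (u + 2 * (m : ℂ)) = 0 := by
    refine eq_zero_of_recurrence hN hΩ hQ hper (f := fun z => ∑ b, v b * w b z) ?_ hu ?_
    · intro z hz
      simp only [Finset.mul_sum]
      rw [Finset.sum_comm]
      refine Finset.sum_eq_zero fun b _ => ?_
      have := hw.solution b z hz
      rw [applyOp_L] at this
      rw [← mul_zero (v b), ← this, Finset.mul_sum]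
      exact Finset.sum_congr rfl fun k _ => by ring
    · intro k hk
      exact congrFun hv0 ⟨k, hk⟩
  -- The constants are extended by zero outside the coset `u + 2ℤ`. The coset is stable under the
  -- shift by `2`, so this is an admissible periodic relation; no regularity of the coefficients is
  -- required.
  let p : Fin (N + 1) → ℂ → ℂ := fun b z => if ∃ m : ℤ, z = u + 2 * (m : ℂ) then v b else 0
  have h2 := hw.independent p (fun b z _ => by
    have : (∃ m : ℤ, z + 2 = u + 2 * (m : ℂ)) ↔ ∃ m : ℤ, z = u + 2 * (m : ℂ) := by
      constructor
      · rintro ⟨m, hm⟩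
        exact ⟨m - 1, by push_cast; linear_combination hm⟩
      · rintro ⟨m, hm⟩
        exact ⟨m + 1, by push_cast; linear_combination hm⟩
    simp only [p, this]) (fun z _ => by
    by_cases hz : ∃ m : ℤ, z = u + 2 * (m : ℂ)
    · simp only [p, if_pos hz]
      obtain ⟨m, rfl⟩ := hz
      exact h1 m
    · simp [p, hz])
  apply hv
  funext b
  have h3 := h2 b u hu
  simp only [p] at h3
  rwa [if_pos ⟨0, by simp⟩] at h3

/-! ### The diagram, and the determinant of Jacobi–Trudi type -/

/-- Entrywise this is the duality at `u + 2k`, which replaces the index `N + 1 - μ'_{j+1} + j - k`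
by `μ'_{j+1} - j + k`. -/
theorem jacobiTrudi_eq_jtDet (hN : 2 ≤ N)
    (hΩ : ∀ u ∈ Ω, ∀ r s : ℤ, u + r + s * halfPeriod ħ ∈ Ω)
    (hQ : ∀ a : ℕ, 1 ≤ a → a ≤ (N + 1) / 2 → ∀ u ∈ Ω, Q a u ≠ 0)
    (hper : ∀ a : ℕ, 1 ≤ a → a ≤ (N + 1) / 2 →
      ∃ h : ℂ, ∀ u ∈ Ω, Q a (u + (Real.pi : ℂ) * Complex.I / ħ) = h * Q a u)
    {μ : YoungDiagram} (hμ : ∀ k, μ.colLen k ≤ N + 1) {u : ℂ} (hu : u ∈ Ω) :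
    jacobiTrudi N ħ Q μ u = jtDet (x N ħ Q) 0 (N + 1)
      (fun k : Fin (μ.rowLen 0) => ((N + 1 - μ.colLen k : ℕ) : ℤ) + (k : ℕ)) u := by
  rw [jacobiTrudi, jtDet]
  congr 1
  ext j k
  have hz := add_two_mul_intCast_mem hΩ hu (k : ℕ)
  rw [Int.cast_natCast] at hz
  rw [Matrix.of_apply, Matrix.of_apply, esym_duality hN hΩ hQ hper _ hz, T_eq_esym,
    YoungDiagram.rowLen_transpose, Nat.cast_sub (hμ j)]
  congr 1
  · push_cast
    ring
  · push_cast
    ring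

end Solutions

/-- Row `N - a`, counted from `0`, has length `i a - a`. Hence, for `l k = N + 1 - colLen k`,
exactly the `i a` with `a < l k` lie below `l k + k`: the numbers `l k + k` fill the gaps of `i`. -/
theorem mem_diagram {N : ℕ} {i : Fin (N + 1) → ℕ} (hi : StrictMono i) (a : Fin (N + 1)) (k : ℕ) :
    N - (a : ℕ) < (diagram i hi).colLen k ↔ k + a < i a := by
  have h := rowLen_diagram i hi (N - a) (by omega)
  rw [← YoungDiagram.mem_iff_lt_colLen, YoungDiagram.mem_iff_lt_rowLen]
  have ha : (⟨N - (N - (a : ℕ)), by omega⟩ : Fin (N + 1)) = a := by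
    apply Fin.ext
    simp only
    omega
  rw [ha] at h
  omega

theorem colLen_diagram_le {N : ℕ} {i : Fin (N + 1) → ℕ} (hi : StrictMono i) (k : ℕ) :
    (diagram i hi).colLen k ≤ N + 1 := by
  by_contra h
  have h1 : (N + 1, k) ∈ diagram i hi := by
    rw [YoungDiagram.mem_iff_lt_colLen]
    omega
  rw [← YoungDiagram.mem_cells] at h1
  simp [diagram] at h1

theorem rowLen_diagram_zero {N : ℕ} {i : Fin (N + 1) → ℕ} (hi : StrictMono i) :
    N + (diagram i hi).rowLen 0 = i (Fin.last N) := by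
  have h := rowLen_diagram i hi 0 (by omega)
  have h2 : (⟨N - 0, by omega⟩ : Fin (N + 1)) = Fin.last N := rfl
  rw [h2] at h
  omega

end TwistedA

end

/-! ### The lemma: the ratio of Casorati determinants and its two expressions. -/

theorem mainTheorem5 (N : ℕ) (hN : 2 ≤ N) (ħ : ℂ) (Ω : Set ℂ)
    (hΩ : ∀ u ∈ Ω, ∀ r s : ℤ, u + r + s * TwistedA.halfPeriod ħ ∈ Ω)
    (Q : ℕ → ℂ → ℂ)
    (hQ : ∀ a : ℕ, 1 ≤ a → a ≤ (N + 1) / 2 → ∀ u ∈ Ω, Q a u ≠ 0)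
    (hper : ∀ a : ℕ, 1 ≤ a → a ≤ (N + 1) / 2 →
      ∃ h : ℂ, ∀ u ∈ Ω, Q a (u + (Real.pi : ℂ) * Complex.I / ħ) = h * Q a u)
    (w : Fin (N + 1) → ℂ → ℂ) (hw : TwistedA.IsSolutionBasis N ħ Q Ω w)
    (hflag : ∀ (a : ℕ) (b : Fin (N + 1)), (b : ℕ) + 1 ≤ a → a ≤ N + 1 →
      ∀ u ∈ Ω, TwistedA.applyOp (TwistedA.Lpart N ħ Q a) (w b) u = 0)
    (i : Fin (N + 1) → ℕ) (hi0 : i 0 = 0) (hi : StrictMono i) (u : ℂ) (hu : u ∈ Ω) :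
    TwistedA.casorati w (fun k => (k : ℕ)) u ≠ 0 ∧
    TwistedA.casorati w i u / TwistedA.casorati w (fun k => (k : ℕ)) u
      = TwistedA.tableauSum N ħ Q (TwistedA.diagram i hi) u ∧
    TwistedA.casorati w i u / TwistedA.casorati w (fun k => (k : ℕ)) u
      = TwistedA.jacobiTrudi N ħ Q (TwistedA.diagram i hi) u := by
  have hne := TwistedA.casorati_ne_zero hN hΩ hQ hper hw hu
  have hmono : Monotone fun k : Fin ((TwistedA.diagram i hi).rowLen 0) =>
      N + 1 - (TwistedA.diagram i hi).colLen k := fun j k hjk =>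
    Nat.sub_le_sub_left ((TwistedA.diagram i hi).colLen_anti j k hjk) _
  have hratio : TwistedA.casorati w i u = TwistedA.jtDet (TwistedA.x N ħ Q) 0 (N + 1)
      (fun k : Fin ((TwistedA.diagram i hi).rowLen 0) =>
        ((N + 1 - (TwistedA.diagram i hi).colLen k : ℕ) : ℤ) + (k : ℕ)) u
      * TwistedA.casorati w (fun k => (k : ℕ)) u := by
    refine TwistedA.casorati_det_eq_jtDet_mul (TwistedA.x N ħ Q) w u (fun b k _ => ?_)
      (fun k _ => ?_) hi hmono (fun k => Nat.sub_le _ _) (fun a => ?_) (fun a k h => ?_)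
      (fun a k h => ?_)
    · rw [← TwistedA.applyOp_L]
      exact hw.solution b _ (TwistedA.add_two_mul_intCast_mem hΩ hu k)
    · exact TwistedA.esym_last hN hΩ hQ hper (TwistedA.add_two_mul_intCast_mem hΩ hu k)
    -- Since `i_N = N + μ_1`, all shifts fit into the window of `N + 1 + μ_1` points on which the
    -- complementary minors are taken.
    · have h1 := TwistedA.rowLen_diagram_zero hi
      have h2 := hi.monotone (Fin.le_last a)
      omega
    · have h1 := TwistedA.mem_diagram hi a k
      have h2 := TwistedA.colLen_diagram_le hi k
      omega
    · have h1 := TwistedA.mem_diagram hi a k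
      have h2 := TwistedA.colLen_diagram_le hi k
      have h3 := a.2
      omega
  refine ⟨hne, ?_, ?_⟩
  · rw [hratio, mul_div_cancel_right₀ _ hne, TwistedA.jtDet_eq_sum_columnFamilies _ _ _ hmono,
      TwistedA.tableauSum, TwistedA.sum_semistandardTableaux]
  · rw [hratio, mul_div_cancel_right₀ _ hne,
      TwistedA.jacobiTrudi_eq_jtDet hN hΩ hQ hper (TwistedA.colLen_diagram_le hi) hu]
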